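/- Let $n\ge 1$, $s\ge 0$ and $1\le p\le q\le\infty$. There is a constant $C>0$, depending only on $n,s,p,q$, with the following property. Let $u_0,u_1,\theta_0$ be (complex-valued) tempered distributions on $\mathbb R^n$ with $|D|^2u_0=-\Delta u_0,\ u_1,\ \theta_0\in L^p(\mathbb R^n)$, and let $(u,\theta)$ be a solution of the Cauchy problem for the thermoelastic plate equations with structural damping $(-\Delta)^{\sigma}u_t$, $\sigma=1$, $$u_{tt}+\Delta^2u+\Delta\theta+(-\Delta)u_t=0,\qquad \theta_t-\Delta\theta-\Delta u_t=0,\qquad t>0,\ x\in\mathbb R^n,$$ $$(u,u_t,\theta)(0,\cdot)=(u_0,u_1,\theta_0),$$ where the equations hold in the sense of tempered distributions: for every Schwartz function $\varphi$ the functions $t\mapsto\langle u(t),\varphi\rangle,\langle u_t(t),\varphi\rangle,\langle\theta(t),\varphi\rangle$ are continuous on $[0,\infty)$ and differentiable on $(0,\infty)$, and the equations hold after pairing with $\varphi$. Then for all $t>0$ $$\big\||D|^2u(t,\cdot)\big\|_{\dot H^s_q}+\|u_t(t,\cdot)\|_{\dot H^s_q}+\|\theta(t,\cdot)\|_{\dot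 H^s_q}\le C\,t^{-\frac s2-\frac n2\left(\frac1p-\frac1q\right)}\Big(\big\||D|^2u_0\big\|_{L^p}+\|u_1\|_{L^p}+\|\theta_0\|_{L^p}\Big);$$ in particular the left-hand side is finite. Here $\|f\|_{\dot H^s_q}=\||D|^sf\|_{L^q}$, where $|D|^s$ has the Fourier symbol $|\xi|^s$ and is applied to a function $f$ by duality: $|D|^sf=g$ means $\int f\,|D|^s\varphi\,dx=\int g\,\varphi\,dx$ for all Schwartz functions $\varphi$, with absolutely convergent integrals; the norm is $\infty$ if there is no such function $g$. -/

import Mathlib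

open MeasureTheory FourierTransform Laplacian
open scoped SchwartzMap ENNReal

noncomputable section

namespace ThermoPlate

/-- The Riesz derivative `|D|^s φ = F⁻¹(|ξ|^s F φ)` of a Schwartz function. With the normalization
`F φ (ξ) = ∫ e^{-2πi⟨x,ξ⟩} φ(x) dx` of Mathlib, the symbol of `|D|^s` is `(2π|ξ|)^s`. -/
def rieszD {n : ℕ} (s : ℝ) (φ : 𝓢(EuclideanSpace ℝ (Fin n), ℂ)) :
    EuclideanSpace ℝ (Fin n) → ℂ :=
  𝓕⁻ (fun ξ : EuclideanSpace ℝ (Fin n) => (((2 * Real.pi * ‖ξ‖) ^ s : ℝ) : ℂ) * (𝓕 φ) ξ)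

/-- The tempered distribution `T` is given by integration against the function `f`. -/
def IsGivenBy {n : ℕ} (T : 𝓢'(EuclideanSpace ℝ (Fin n), ℂ))
    (f : EuclideanSpace ℝ (Fin n) → ℂ) : Prop :=
  ∀ φ : 𝓢(EuclideanSpace ℝ (Fin n), ℂ),
    Integrable (fun x => φ x * f x) volume ∧ T φ = ∫ x, φ x * f x

/-- `|D|^s T = g`: the distribution `T` is a function `f`, and the function `g` satisfies
`∫ φ g = ∫ (|D|^s φ) f` for all Schwartz functions `φ`, all integrals being absolutely convergent.
Such a `g` is unique up to null sets. -/
def IsRieszDeriv {n : ℕ} (s : ℝ) (T : 𝓢'(EuclideanSpace ℝ (Fin n), ℂ))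
    (g : EuclideanSpace ℝ (Fin n) → ℂ) : Prop :=
  ∃ f : EuclideanSpace ℝ (Fin n) → ℂ, IsGivenBy T f ∧
    ∀ φ : 𝓢(EuclideanSpace ℝ (Fin n), ℂ),
      Integrable (fun x => rieszD s φ x * f x) volume ∧
      Integrable (fun x => φ x * g x) volume ∧
      ∫ x, rieszD s φ x * f x = ∫ x, φ x * g x

/-- The homogeneous (Riesz potential) norm `‖T‖_{Ḣ^s_q} = ‖|D|^s T‖_{L^q}`; it is `∞` if `|D|^s T`
does not exist as a function. The infimum runs over a single class of a.e. equal functions. -/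
def rieszNorm {n : ℕ} (s : ℝ) (q : ℝ≥0∞) (T : 𝓢'(EuclideanSpace ℝ (Fin n), ℂ)) : ℝ≥0∞ :=
  ⨅ (g : EuclideanSpace ℝ (Fin n) → ℂ) (_ : IsRieszDeriv s T g), eLpNorm g q volume

/-- `(u, θ)`, with `ut = ∂ₜu`, solves in the sense of tempered distributions
`u_tt + Δ²u + Δθ + (-Δ)u_t = 0`, `θ_t - Δθ - Δu_t = 0` for `t > 0`, with
`(u, u_t, θ)(0) = (u₀, u₁, θ₀)`. Here `u`, `u_t`, `θ` are weakly continuous on `[0, ∞)` and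
weakly differentiable in time on `(0, ∞)` as families of tempered distributions. -/
structure IsSolution {n : ℕ} (u ut θ : ℝ → 𝓢'(EuclideanSpace ℝ (Fin n), ℂ))
    (u₀ u₁ θ₀ : 𝓢'(EuclideanSpace ℝ (Fin n), ℂ)) : Prop where
  continuousOn_u : ∀ φ : 𝓢(EuclideanSpace ℝ (Fin n), ℂ),
    ContinuousOn (fun t => u t φ) (Set.Ici 0)
  continuousOn_ut : ∀ φ : 𝓢(EuclideanSpace ℝ (Fin n), ℂ),
    ContinuousOn (fun t => ut t φ) (Set.Ici 0)
  continuousOn_θ : ∀ φ : 𝓢(EuclideanSpace ℝ (Fin n), ℂ),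
    ContinuousOn (fun t => θ t φ) (Set.Ici 0)
  hasDerivAt_u : ∀ φ : 𝓢(EuclideanSpace ℝ (Fin n), ℂ), ∀ t : ℝ, 0 < t →
    HasDerivAt (fun τ => u τ φ) (ut t φ) t
  plate_eq : ∀ φ : 𝓢(EuclideanSpace ℝ (Fin n), ℂ), ∀ t : ℝ, 0 < t → ∃ utt : ℂ,
    HasDerivAt (fun τ => ut τ φ) utt t ∧
    utt + Δ (Δ (u t)) φ + Δ (θ t) φ + (-Δ (ut t)) φ = 0
  heat_eq : ∀ φ : 𝓢(EuclideanSpace ℝ (Fin n), ℂ), ∀ t : ℝ, 0 < t → ∃ θt : ℂ,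
    HasDerivAt (fun τ => θ τ φ) θt t ∧ θt - Δ (θ t) φ - Δ (ut t) φ = 0
  initial_u : u 0 = u₀
  initial_ut : ut 0 = u₁
  initial_θ : θ 0 = θ₀

end ThermoPlate

end

/-! Put `W = (-Δu, u_t, θ)`. The plate system becomes `W' = Δ M W` with a constant 3×3 matrix `M`
whose characteristic polynomial is `z³ - 2z² + 3z - 1`. Its roots `l` are distinct and have positive
real part, and `(1, l, l² - l + 1)` is a left eigenvector. Hence each `mode` `-Δu + l u_t + (l² - l
+ 1) θ` solves the scalar heat equation `v' = l Δ v`, and every component of `W` is a fixed linear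
combination of the three modes (`exists_combination`, by Vandermonde).

A weakly continuous tempered solution of the scalar equation is unique (`eq_expMul_of_hasDerivAt`):
on the Fourier side, `s ↦ T(t - s)(e^{-cs‖ξ‖²} ψ)` has zero right derivative. Since both the
functional and the test function move, this needs a bound on `T` uniform in time, which comes from
Banach–Steinhaus on the Schwartz space. So a mode at time `t` is its initial datum convolved with a
complex Gaussian kernel.

It remains to estimate convolution with the kernel of `|D|^s e^{ltΔ}`. Parabolic scaling reduces its
norms to `t = 1`. There it is bounded because its symbol is integrable, and integrable because a
fractional power of `-Δ` is a superposition of heat symbols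
(`lintegral_fourierInv_lapSymbol_rpow_lt_top`). Young's inequality (`eLpNorm_conv_le`) then gives
the decay rate for all `1 ≤ p ≤ q ≤ ∞`, endpoints included. The duality form of `|D|^s` is verified
by moving the even kernel onto the test function. -/

noncomputable section

namespace ThermoPlate

open Filter Topology
open scoped RealInnerProductSpace

/-! ### The Schwartz space is complete and Baire; uniform boundedness -/

section Barrelled

open scoped ContDiff

variable {V : Type*} [NormedAddCommGroup V] [NormedSpace ℝ V]

theorem iteratedFDeriv_tsum_schwartz {d : ℕ → 𝓢(V, ℂ)}
    (hd : ∀ k l : ℕ, Summable fun i => SchwartzMap.seminorm ℝ k l (d i)) (l : ℕ) (x : V) :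
    iteratedFDeriv ℝ l (fun y => ∑' i, d i y) x = ∑' i, iteratedFDeriv ℝ l (d i) x :=
  iteratedFDeriv_tsum_apply (N := (⊤ : ℕ∞)) (v := fun l i => SchwartzMap.seminorm ℝ 0 l (d i))
    (fun i => (d i).smooth _) (fun k _ => hd 0 k)
    (fun k i x _ => SchwartzMap.norm_iteratedFDeriv_le_seminorm ℝ (d i) k x) le_top x

theorem norm_pow_mul_iteratedFDeriv_tsum_le {d : ℕ → 𝓢(V, ℂ)}
    (hd : ∀ k l : ℕ, Summable fun i => SchwartzMap.seminorm ℝ k l (d i)) (k l : ℕ) (x : V) :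
    ‖x‖ ^ k * ‖iteratedFDeriv ℝ l (fun y => ∑' i, d i y) x‖
      ≤ ∑' i, SchwartzMap.seminorm ℝ k l (d i) := by
  have h0 : Summable fun i => ‖iteratedFDeriv ℝ l (d i) x‖ :=
    (hd 0 l).of_nonneg_of_le (fun _ => norm_nonneg _)
      fun i => SchwartzMap.norm_iteratedFDeriv_le_seminorm ℝ (d i) l x
  rw [iteratedFDeriv_tsum_schwartz hd]
  calc _ ≤ ‖x‖ ^ k * ∑' i, ‖iteratedFDeriv ℝ l (d i) x‖ := by
        gcongr; exact norm_tsum_le_tsum_norm h0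
    _ = ∑' i, ‖x‖ ^ k * ‖iteratedFDeriv ℝ l (d i) x‖ := tsum_mul_left.symm
    _ ≤ _ := (h0.mul_left _).tsum_le_tsum (fun i => SchwartzMap.le_seminorm ℝ k l (d i) x) (hd k l)

/-- Summability in every seminorm lets the series be differentiated termwise, and the tails of the
seminorm series bound the error. Completeness reduces to this case, because a rapidly Cauchy
sequence has summable increments. -/
theorem exists_tendsto_sum_schwartz {d : ℕ → 𝓢(V, ℂ)}
    (hd : ∀ k l : ℕ, Summable fun i => SchwartzMap.seminorm ℝ k l (d i)) :
    ∃ S : 𝓢(V, ℂ), Tendsto (fun N => ∑ i ∈ Finset.range N, d i) atTop (𝓝 S) := by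
  let S : 𝓢(V, ℂ) :=
    { toFun := fun y => ∑' i, d i y
      smooth' := contDiff_tsum (N := (⊤ : ℕ∞)) (v := fun l i => SchwartzMap.seminorm ℝ 0 l (d i))
        (fun i => (d i).smooth _) (fun k _ => hd 0 k)
        (fun k i x _ => SchwartzMap.norm_iteratedFDeriv_le_seminorm ℝ (d i) k x)
      decay' := fun k l => ⟨_, norm_pow_mul_iteratedFDeriv_tsum_le hd k l⟩ }
  refine ⟨S, ?_⟩
  rw [(schwartz_withSeminorms ℝ V ℂ).tendsto_nhds]
  rintro ⟨k, l⟩ ε hε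
  have htail : ∀ N, SchwartzMap.seminorm ℝ k l (∑ i ∈ Finset.range N, d i - S)
      ≤ ∑' i, SchwartzMap.seminorm ℝ k l (d (i + N)) := by
    intro N
    rw [map_sub_rev]
    refine SchwartzMap.seminorm_le_bound ℝ k l _ (tsum_nonneg fun i => apply_nonneg _ _) fun x => ?_
    have hfun : ⇑(S - ∑ i ∈ Finset.range N, d i) = fun y => ∑' i, d (i + N) y := by
      ext y
      have hy : Summable fun i => d i y :=
        Summable.of_norm_bounded (hd 0 0) fun i => SchwartzMap.norm_le_seminorm ℝ (d i) y
      have h2 := hy.sum_add_tsum_nat_add N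
      have h3 : (∑ i ∈ Finset.range N, d i) y = ∑ i ∈ Finset.range N, d i y := by simp
      change (∑' i, d i y) - (∑ i ∈ Finset.range N, d i) y = _
      rw [h3, ← h2]; ring
    rw [hfun]
    exact norm_pow_mul_iteratedFDeriv_tsum_le (d := fun i => d (i + N))
      (fun k l => (summable_nat_add_iff N).2 (hd k l)) k l x
  have h0 := tendsto_sum_nat_add (fun i => SchwartzMap.seminorm ℝ k l (d i))
  filter_upwards [h0.eventually_lt_const hε] with N hN
  exact (htail N).trans_lt hN

instance uniformity_countablyGenerated_schwartz : (uniformity 𝓢(V, ℂ)).IsCountablyGenerated :=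
  IsUniformAddGroup.uniformity_countably_generated

instance completeSpace_schwartz : CompleteSpace 𝓢(V, ℂ) := by
  -- The `N`-th entourage constrains only the seminorms with indices up to `N`. A given seminorm of
  -- the increments is therefore bounded by `2⁻ⁱ` from `i = max k l` on, which is enough for
  -- summability.
  let U : ℕ → Set (𝓢(V, ℂ) × 𝓢(V, ℂ)) := fun N =>
    {p | ∀ m ∈ Finset.range (N + 1) ×ˢ Finset.range (N + 1),
      SchwartzMap.seminorm ℝ m.1 m.2 (p.2 - p.1) < (1 / 2) ^ N}
  have hU : ∀ N, U N ∈ uniformity 𝓢(V, ℂ) := by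
    intro N
    rw [uniformity_eq_comap_nhds_zero]
    refine ⟨{f | ∀ m ∈ Finset.range (N + 1) ×ˢ Finset.range (N + 1),
      SchwartzMap.seminorm ℝ m.1 m.2 f < (1 / 2) ^ N}, ?_, fun p hp => hp⟩
    change ∀ᶠ f in 𝓝 (0 : 𝓢(V, ℂ)), _
    refine (Finset.eventually_all _).2 fun m _ => ?_
    have := ((schwartz_withSeminorms ℝ V ℂ).continuous_seminorm m).tendsto 0
    simp only [map_zero, schwartzSeminormFamily] at this
    exact this.eventually_lt_const (by positivity)
  refine UniformSpace.complete_of_convergent_controlled_sequences U hU fun u hu => ?_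
  have hd : ∀ k l : ℕ, Summable fun i => SchwartzMap.seminorm ℝ k l (u (i + 1) - u i) := by
    intro k l
    refine Summable.of_norm_bounded_eventually_nat (g := fun i => (1 / 2 : ℝ) ^ i)
      summable_geometric_two ?_
    filter_upwards [eventually_ge_atTop (max k l)] with i hi
    rw [Real.norm_of_nonneg (apply_nonneg _ _)]
    refine (hu i i (i + 1) le_rfl (Nat.le_succ i) (k, l) ?_).le
    simp only [Finset.mem_product, Finset.mem_range]
    omega
  obtain ⟨S, hS⟩ := exists_tendsto_sum_schwartz hd
  refine ⟨S + u 0, ?_⟩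
  have : ∀ N, ∑ i ∈ Finset.range N, (u (i + 1) - u i) + u 0 = u N := fun N => by
    rw [Finset.sum_range_sub]; abel
  exact (hS.add_const (u 0)).congr this

instance baireSpace_schwartz : BaireSpace 𝓢(V, ℂ) := by
  let _ := UniformSpace.pseudoMetricSpace 𝓢(V, ℂ)
  infer_instance

/-- A pointwise bounded family of continuous functionals on the Schwartz space is bounded by a
single continuous seminorm. -/
theorem exists_seminorm_bound_of_pointwise_bounded {ι : Type*} (T : ι → 𝓢(V, ℂ) →L[ℂ] ℂ)
    (hT : ∀ φ, ∃ M : ℝ, ∀ i, ‖T i φ‖ ≤ M) :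
    ∃ (m : ℕ × ℕ) (C : ℝ), 0 ≤ C ∧ ∀ i φ, ‖T i φ‖ ≤
      C * (Finset.Iic m).sup (fun m => SchwartzMap.seminorm ℂ m.1 m.2) φ := by
  let q : ι → Seminorm ℂ 𝓢(V, ℂ) := fun i => (normSeminorm ℂ ℂ).comp (T i).toLinearMap
  have hbdd : BddAbove (Set.range q) := by
    rw [Seminorm.bddAbove_range_iff]
    intro φ
    obtain ⟨M, hM⟩ := hT φ
    exact ⟨M, by rintro _ ⟨i, rfl⟩; exact hM i⟩
  have hc := Seminorm.continuous_iSup q (fun i => (T i).continuous.norm) hbdd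
  rw [← Seminorm.coe_iSup_eq hbdd] at hc
  obtain ⟨s, C, -, hC⟩ := Seminorm.bound_of_continuous (schwartz_withSeminorms ℂ V ℂ) _ hc
  refine ⟨(s.sup Prod.fst, s.sup Prod.snd), C, C.2, fun i φ => ?_⟩
  have h1 : ‖T i φ‖ ≤ (⨆ i, q i) φ := by
    obtain ⟨M, hM⟩ := hT φ
    rw [Seminorm.iSup_apply hbdd]
    exact le_ciSup (f := fun i => q i φ) ⟨M, by rintro _ ⟨i, rfl⟩; exact hM i⟩ i
  refine h1.trans ((Seminorm.le_def.1 hC φ).trans ?_)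
  change (C : ℝ) * _ ≤ _
  gcongr
  refine Seminorm.le_def.1 (Finset.sup_mono fun m hm => ?_) φ
  exact Finset.mem_Iic.2 ⟨Finset.le_sup (f := Prod.fst) hm, Finset.le_sup (f := Prod.snd) hm⟩

end Barrelled

/-! ### Radial multipliers `E(‖ξ‖²)` on the Schwartz space, with quantitative bounds -/

section RadialMultiplier

open scoped ContDiff

variable {V : Type*} [NormedAddCommGroup V] [InnerProductSpace ℝ V]

/-- The supremum of the Schwartz seminorms with indices up to `m`. -/
def supSeminorm (m : ℕ × ℕ) : Seminorm ℂ 𝓢(V, ℂ) :=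
  (Finset.Iic m).sup fun m => SchwartzMap.seminorm ℂ m.1 m.2

theorem supSeminorm_mono {m m' : ℕ × ℕ} (h : m ≤ m') (φ : 𝓢(V, ℂ)) :
    supSeminorm m φ ≤ supSeminorm m' φ :=
  Seminorm.le_def.1 (Finset.sup_mono (Finset.Iic_subset_Iic.2 h)) φ

variable (V) in
-- The constants are chosen before `E` and the bound is linear in `B`, so smallness of the profile
-- `E` passes to the multiplier.
theorem exists_norm_iteratedFDeriv_comp_normSq_le (l : ℕ) :
    ∃ (D : ℝ) (k : ℕ), 0 ≤ D ∧ ∀ (E : ℝ → ℂ) (x : V) (B : ℝ), ContDiff ℝ ∞ E →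
      (∀ i ≤ l, ‖iteratedDeriv i E (‖x‖ ^ 2)‖ ≤ B) →
      ∀ j ≤ l, ‖iteratedFDeriv ℝ j (fun ξ : V => E (‖ξ‖ ^ 2)) x‖ ≤ D * B * (1 + ‖x‖) ^ k := by
  obtain ⟨k, C, hC, h⟩ := (Function.hasTemperateGrowth_norm_sq V).norm_iteratedFDeriv_le_uniform l
  refine ⟨(l.factorial : ℝ) * (1 + C) ^ l, k * l, by positivity, fun E x B hE hB j hj => ?_⟩
  have hB0 : 0 ≤ B := (norm_nonneg _).trans (hB 0 (Nat.zero_le _))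
  have h1 : (1 : ℝ) ≤ (1 + ‖x‖) ^ k := one_le_pow₀ (by simp)
  -- The chain-rule estimate wants the `i`-th derivative of `‖ξ‖²` bounded by an `i`-th power; a
  -- base that is at least `1` makes a single bound serve for every `i ≥ 1`.
  have hD1 : (1 : ℝ) ≤ (1 + C) * (1 + ‖x‖) ^ k := one_le_mul_of_one_le_of_one_le (by simpa) h1
  have := norm_iteratedFDeriv_comp_le (n := j) (g := E) (f := fun ξ : V => ‖ξ‖ ^ 2) (x := x)
    (C := B) (D := (1 + C) * (1 + ‖x‖) ^ k) hE (Function.hasTemperateGrowth_norm_sq V).1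
    (mod_cast le_top)
    (fun i hi => by
      rw [norm_iteratedFDeriv_eq_norm_iteratedDeriv]; exact hB i (hi.trans hj))
    (fun i hi hi' => by
      refine (h i (hi'.trans hj) x).trans ((le_trans ?_ (le_self_pow₀ hD1 (by omega))))
      gcongr; simp)
  refine this.trans ?_
  calc _ ≤ (l.factorial : ℝ) * B * ((1 + C) * (1 + ‖x‖) ^ k) ^ l := by
        gcongr
    _ = _ := by rw [mul_pow, ← pow_mul]; ring

theorem hasTemperateGrowth_radial {E : ℝ → ℂ} (hE : ContDiff ℝ ∞ E)
    (h : ∀ l : ℕ, ∃ A : ℝ, ∀ i ≤ l, ∀ r : ℝ, 0 ≤ r → ‖iteratedDeriv i E r‖ ≤ A * (1 + r) ^ 2) :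
    Function.HasTemperateGrowth fun ξ : V => E (‖ξ‖ ^ 2) := by
  refine ⟨hE.comp (Function.hasTemperateGrowth_norm_sq V).1, fun l => ?_⟩
  obtain ⟨A, hA⟩ := h l
  obtain ⟨D, k, hD, H⟩ := exists_norm_iteratedFDeriv_comp_normSq_le V l
  have hA0 : 0 ≤ A := by simpa using (norm_nonneg _).trans (hA 0 (Nat.zero_le _) 0 le_rfl)
  refine ⟨4 + k, D * A, fun x => ?_⟩
  refine (H E x _ hE (fun i hi => hA i hi _ (by positivity)) l le_rfl).trans ?_
  have : (1 + ‖x‖ ^ 2) ^ 2 ≤ (1 + ‖x‖) ^ 4 := by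
    have h0 := norm_nonneg x
    calc (1 + ‖x‖ ^ 2) ^ 2 ≤ ((1 + ‖x‖) ^ 2) ^ 2 := by gcongr; nlinarith
      _ = _ := by ring
  calc _ ≤ D * (A * (1 + ‖x‖) ^ 4) * (1 + ‖x‖) ^ k := by gcongr
    _ = _ := by ring

/-- The weight `(1 + r)²` is the growth of the second-order Taylor remainder of the exponential, the
worst profile used below. Linearity in `A` later carries the factors `h` and `h²`. -/
theorem exists_seminorm_smulLeft_radial_le (k l : ℕ) :
    ∃ (K : ℝ) (m : ℕ × ℕ), 0 ≤ K ∧ ∀ (E : ℝ → ℂ) (A : ℝ), ContDiff ℝ ∞ E →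
      Function.HasTemperateGrowth (fun ξ : V => E (‖ξ‖ ^ 2)) →
      (∀ i ≤ l, ∀ r : ℝ, 0 ≤ r → ‖iteratedDeriv i E r‖ ≤ A * (1 + r) ^ 2) → ∀ φ : 𝓢(V, ℂ),
      SchwartzMap.seminorm ℂ k l (SchwartzMap.smulLeftCLM ℂ (fun ξ : V => E (‖ξ‖ ^ 2)) φ)
        ≤ A * K * supSeminorm m φ := by
  obtain ⟨D, k', hD, H⟩ := exists_norm_iteratedFDeriv_comp_normSq_le V l
  -- `2 ^ l` sums the binomial coefficients of the Leibniz rule. The exponent collects `k` from the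
  -- seminorm, `4` from `(1 + ‖x‖²)² ≤ (1 + ‖x‖)⁴` and `k'` from the chain rule.
  refine ⟨2 ^ l * D * 2 ^ (k + 4 + k'), (k + 4 + k', l), by positivity,
    fun E A hE htemp hA φ => ?_⟩
  have hA0 : 0 ≤ A := by simpa using (norm_nonneg _).trans (hA 0 (Nat.zero_le _) 0 le_rfl)
  have hS : 0 ≤ supSeminorm (k + 4 + k', l) φ := apply_nonneg _ _
  refine SchwartzMap.seminorm_le_bound ℂ k l _ (by positivity) fun x => ?_
  rw [SchwartzMap.smulLeftCLM_apply htemp]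
  have hx := norm_nonneg x
  have h4 : (1 + ‖x‖ ^ 2) ^ 2 ≤ (1 + ‖x‖) ^ 4 := by
    calc (1 + ‖x‖ ^ 2) ^ 2 ≤ ((1 + ‖x‖) ^ 2) ^ 2 := by gcongr; nlinarith
      _ = _ := by ring
  calc _ ≤ (1 + ‖x‖) ^ k * ∑ i ∈ Finset.range (l + 1), (l.choose i : ℝ) *
        ‖iteratedFDeriv ℝ i (fun ξ : V => E (‖ξ‖ ^ 2)) x‖ * ‖iteratedFDeriv ℝ (l - i) φ x‖ := by
        gcongr
        · linarith
        · exact norm_iteratedFDeriv_smul_le (N := (∞ : ℕ∞ω)) htemp.1 (φ.smooth ⊤) x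
            (mod_cast le_top)
    _ ≤ (1 + ‖x‖) ^ k * ∑ i ∈ Finset.range (l + 1), (l.choose i : ℝ) *
        (D * (A * (1 + ‖x‖) ^ 4) * (1 + ‖x‖) ^ k') * ‖iteratedFDeriv ℝ (l - i) φ x‖ := by
        gcongr with i hi
        refine (H E x _ hE (fun i hi => hA i hi _ (by positivity)) i
          (Nat.lt_succ_iff.1 (Finset.mem_range.1 hi))).trans ?_
        gcongr
    _ = ∑ i ∈ Finset.range (l + 1), (l.choose i : ℝ) * (D * A) *
        ((1 + ‖x‖) ^ (k + 4 + k') * ‖iteratedFDeriv ℝ (l - i) φ x‖) := by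
        rw [Finset.mul_sum]; refine Finset.sum_congr rfl fun i _ => ?_; ring
    _ ≤ ∑ i ∈ Finset.range (l + 1), (l.choose i : ℝ) * (D * A) *
        (2 ^ (k + 4 + k') * supSeminorm (k + 4 + k', l) φ) := by
        refine Finset.sum_le_sum fun i _ => mul_le_mul_of_nonneg_left ?_ (by positivity)
        exact SchwartzMap.one_add_le_sup_seminorm_apply (𝕜 := ℂ) (m := (k + 4 + k', l)) le_rfl
          (Nat.sub_le _ _) φ x
    _ = _ := by
        rw [← Finset.sum_mul, ← Finset.sum_mul]
        have : ∑ i ∈ Finset.range (l + 1), (l.choose i : ℝ) = 2 ^ l := by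
          exact_mod_cast Nat.sum_range_choose l
        rw [this]; ring

theorem exists_supSeminorm_smulLeft_radial_le (m : ℕ × ℕ) :
    ∃ (K : ℝ) (m' : ℕ × ℕ), 0 ≤ K ∧ ∀ (E : ℝ → ℂ) (A : ℝ), ContDiff ℝ ∞ E →
      Function.HasTemperateGrowth (fun ξ : V => E (‖ξ‖ ^ 2)) →
      (∀ i ≤ m.2, ∀ r : ℝ, 0 ≤ r → ‖iteratedDeriv i E r‖ ≤ A * (1 + r) ^ 2) → ∀ φ : 𝓢(V, ℂ),
      supSeminorm m (SchwartzMap.smulLeftCLM ℂ (fun ξ : V => E (‖ξ‖ ^ 2)) φ)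
        ≤ A * K * supSeminorm m' φ := by
  choose K M hK H using exists_seminorm_smulLeft_radial_le (V := V)
  let s := Finset.Iic m
  refine ⟨∑ a ∈ s, K a.1 a.2,
    (s.sup fun a => (M a.1 a.2).1, s.sup fun a => (M a.1 a.2).2),
    Finset.sum_nonneg fun a _ => hK _ _, fun E A hE htemp hA φ => ?_⟩
  have hA0 : 0 ≤ A := by simpa using (norm_nonneg _).trans (hA 0 (Nat.zero_le _) 0 le_rfl)
  have hsum : 0 ≤ ∑ a ∈ s, K a.1 a.2 := Finset.sum_nonneg fun a _ => hK _ _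
  refine Seminorm.finset_sup_apply_le (mul_nonneg (mul_nonneg hA0 hsum) (apply_nonneg _ _))
    fun a ha => ?_
  have ha' := Finset.mem_Iic.1 ha
  refine (H a.1 a.2 E A hE htemp (fun i hi => hA i (hi.trans ha'.2)) φ).trans ?_
  have h1 : K a.1 a.2 ≤ ∑ a ∈ s, K a.1 a.2 :=
    Finset.single_le_sum (f := fun a : ℕ × ℕ => K a.1 a.2) (fun a _ => hK _ _) ha
  have h2 : supSeminorm (M a.1 a.2) φ ≤ supSeminorm
      (s.sup fun a => (M a.1 a.2).1, s.sup fun a => (M a.1 a.2).2) φ :=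
    supSeminorm_mono ⟨Finset.le_sup (f := fun a : ℕ × ℕ => (M a.1 a.2).1) ha,
      Finset.le_sup (f := fun a : ℕ × ℕ => (M a.1 a.2).2) ha⟩ φ
  have h3 : 0 ≤ supSeminorm (M a.1 a.2) φ := apply_nonneg _ _
  gcongr

end RadialMultiplier

/-! ### Taylor remainders of `e^{-cr}` and their derivatives -/

section ExponentialMultiplier

open scoped ContDiff

theorem norm_cexp_le_one {z : ℂ} (hz : z.re ≤ 0) : ‖Complex.exp z‖ ≤ 1 := by
  rw [Complex.norm_exp]; exact Real.exp_le_one_iff.2 hz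

theorem norm_cexp_sub_one_le {z : ℂ} (hz : z.re ≤ 0) : ‖Complex.exp z - 1‖ ≤ 2 * ‖z‖ := by
  rcases le_total ‖z‖ 1 with h | h
  · exact Complex.norm_exp_sub_one_le h
  · calc _ ≤ ‖Complex.exp z‖ + ‖(1 : ℂ)‖ := norm_sub_le _ _
      _ ≤ 1 + 1 := by gcongr; exacts [norm_cexp_le_one hz, norm_one.le]
      _ ≤ _ := by linarith

/-- In the left half-plane the exponential is bounded by `1`, so the remainder estimate for `‖z‖ ≤
1` extends to large `z` after enlarging the constant. -/
theorem norm_cexp_sub_one_sub_id_le {z : ℂ} (hz : z.re ≤ 0) :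
    ‖Complex.exp z - 1 - z‖ ≤ 3 * ‖z‖ ^ 2 := by
  rcases le_total ‖z‖ 1 with h | h
  · exact (Complex.norm_exp_sub_one_sub_id_le h).trans (by nlinarith [norm_nonneg z])
  · calc _ ≤ ‖Complex.exp z‖ + ‖(1 : ℂ)‖ + ‖z‖ :=
        (norm_sub_le _ _).trans (by gcongr; exact norm_sub_le _ _)
      _ ≤ 1 + 1 + ‖z‖ := by gcongr; exacts [norm_cexp_le_one hz, norm_one.le]
      _ ≤ _ := by nlinarith

theorem hasDerivAt_cexp_neg_mul (c : ℂ) (r : ℝ) :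
    HasDerivAt (fun r : ℝ => Complex.exp (-(c * r))) (-c * Complex.exp (-(c * r))) r := by
  have h : HasDerivAt (fun r : ℝ => -(c * (r : ℂ))) (-(c * 1)) r :=
    ((Complex.ofRealCLM.hasDerivAt (x := r)).const_mul c).neg
  convert! h.cexp using 1
  ring

theorem contDiff_cexp_neg_mul (c : ℂ) : ContDiff ℝ ∞ fun r : ℝ => Complex.exp (-(c * r)) :=
  (contDiff_const.mul Complex.ofRealCLM.contDiff).neg.cexp

theorem iteratedDeriv_cexp_neg_mul (c : ℂ) (i : ℕ) :
    iteratedDeriv i (fun r : ℝ => Complex.exp (-(c * r)))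
      = fun r : ℝ => (-c) ^ i * Complex.exp (-(c * r)) := by
  induction i with
  | zero => ext r; simp
  | succ i ih =>
    ext r
    rw [iteratedDeriv_succ, ih, ((hasDerivAt_cexp_neg_mul c r).const_mul _).deriv]
    ring

theorem deriv_cexp_neg_mul_sub_one (c : ℂ) :
    deriv (fun r : ℝ => Complex.exp (-(c * r)) - 1)
      = fun r : ℝ => -c * Complex.exp (-(c * r)) :=
  funext fun r => ((hasDerivAt_cexp_neg_mul c r).sub_const 1).deriv

theorem iteratedDeriv_cexp_neg_mul_sub_one (c : ℂ) (i : ℕ) :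
    iteratedDeriv (i + 1) (fun r : ℝ => Complex.exp (-(c * r)) - 1)
      = fun r : ℝ => (-c) ^ (i + 1) * Complex.exp (-(c * r)) := by
  induction i with
  | zero => rw [zero_add, iteratedDeriv_one, deriv_cexp_neg_mul_sub_one]; simp
  | succ i ih =>
    ext r
    rw [iteratedDeriv_succ, ih, ((hasDerivAt_cexp_neg_mul c r).const_mul _).deriv]
    ring

theorem deriv_cexp_neg_mul_sub_one_add (c : ℂ) :
    deriv (fun r : ℝ => Complex.exp (-(c * r)) - 1 + c * r)
      = fun r : ℝ => -c * (Complex.exp (-(c * r)) - 1) :=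
  funext fun r => by
    have h := ((hasDerivAt_cexp_neg_mul c r).sub_const 1).add
      ((Complex.ofRealCLM.hasDerivAt (x := r)).const_mul c)
    have h2 := h.deriv
    rw [show -c * (Complex.exp (-(c * r)) - 1) = -c * Complex.exp (-(c * r)) + c * 1 by ring]
    exact h2

theorem iteratedDeriv_cexp_neg_mul_sub_one_add (c : ℂ) (i : ℕ) :
    iteratedDeriv (i + 2) (fun r : ℝ => Complex.exp (-(c * r)) - 1 + c * r)
      = fun r : ℝ => (-c) ^ (i + 2) * Complex.exp (-(c * r)) := by
  induction i with
  | zero =>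
    ext r
    rw [zero_add, iteratedDeriv_succ, iteratedDeriv_one, deriv_cexp_neg_mul_sub_one_add,
      (((hasDerivAt_cexp_neg_mul c r).sub_const 1).const_mul _).deriv]
    ring
  | succ i ih =>
    ext r
    rw [iteratedDeriv_succ, ih, ((hasDerivAt_cexp_neg_mul c r).const_mul _).deriv]
    ring

variable {c : ℂ} (hc : 0 ≤ c.re)
include hc

theorem re_neg_mul_ofReal_nonpos {r : ℝ} (hr : 0 ≤ r) : (-(c * (r : ℂ))).re ≤ 0 := by
  simp; positivity

theorem norm_iteratedDeriv_cexp_neg_mul_le {l i : ℕ} (hi : i ≤ l) {r : ℝ} (hr : 0 ≤ r) :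
    ‖iteratedDeriv i (fun r : ℝ => Complex.exp (-(c * r))) r‖ ≤ (1 + ‖c‖) ^ l * (1 + r) ^ 2 := by
  rw [iteratedDeriv_cexp_neg_mul, norm_mul, norm_pow, norm_neg]
  have h1 : ‖c‖ ^ i ≤ (1 + ‖c‖) ^ l :=
    (pow_le_pow_left₀ (norm_nonneg _) (by linarith) i).trans
      (pow_le_pow_right₀ (by linarith [norm_nonneg c]) hi)
  have h2 := norm_cexp_le_one (re_neg_mul_ofReal_nonpos hc hr)
  have h3 : (1 : ℝ) ≤ (1 + r) ^ 2 := one_le_pow₀ (by linarith)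
  gcongr
  exact h2.trans h3

/-- The factor `h` comes from the Taylor remainder at order zero and from differentiating the
exponent at higher orders; surplus powers of `h` are absorbed by `h ≤ 1`. -/
theorem norm_iteratedDeriv_cexp_neg_mul_sub_one_le {h : ℝ} (h0 : 0 ≤ h) (h1 : h ≤ 1) {l i : ℕ}
    (hi : i ≤ l) {r : ℝ} (hr : 0 ≤ r) :
    ‖iteratedDeriv i (fun r : ℝ => Complex.exp (-(c * h * r)) - 1) r‖
      ≤ (2 * (1 + ‖c‖) ^ (l + 1) * h) * (1 + r) ^ 2 := by
  have hc' : 0 ≤ (c * h).re := by simp; positivity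
  have hnc := norm_nonneg c
  have hn : ‖c * (h : ℂ)‖ = ‖c‖ * h := by rw [norm_mul, Complex.norm_of_nonneg h0]
  have hre := re_neg_mul_ofReal_nonpos hc' hr
  have h3 : (1 : ℝ) ≤ (1 + r) ^ 2 := one_le_pow₀ (by linarith)
  rcases i with _ | i
  · rw [iteratedDeriv_zero]
    refine (norm_cexp_sub_one_le hre).trans ?_
    rw [norm_neg, norm_mul, hn, Complex.norm_of_nonneg hr]
    have h4 : ‖c‖ ≤ (1 + ‖c‖) ^ (l + 1) :=
      (by linarith : ‖c‖ ≤ 1 + ‖c‖).trans (le_self_pow₀ (by linarith) (by omega))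
    have h5 : r ≤ (1 + r) ^ 2 := by nlinarith
    calc 2 * (‖c‖ * h * r) = 2 * ‖c‖ * h * r := by ring
      _ ≤ _ := by gcongr
  · rw [iteratedDeriv_cexp_neg_mul_sub_one, norm_mul, norm_pow, norm_neg, hn, mul_pow]
    have h4 : ‖c‖ ^ (i + 1) ≤ (1 + ‖c‖) ^ (l + 1) :=
      (pow_le_pow_left₀ (norm_nonneg _) (by linarith) _).trans
        (pow_le_pow_right₀ (by linarith) (by omega))
    have h5 : h ^ (i + 1) ≤ h := by
      rw [pow_succ]; exact mul_le_of_le_one_left h0 (pow_le_one₀ h0 h1)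
    have h6 : (0 : ℝ) ≤ (1 + ‖c‖) ^ (l + 1) := by positivity
    calc _ ≤ (1 + ‖c‖) ^ (l + 1) * h * 1 := by
          gcongr; exact norm_cexp_le_one hre
      _ ≤ _ := by gcongr; linarith

/-- As before, now with `h²`: order zero uses the quadratic remainder, order one combines one factor
from the derivative with a linear remainder, and from order two on the subtracted polynomial has
disappeared. -/
theorem norm_iteratedDeriv_cexp_neg_mul_sub_one_add_le {h : ℝ} (h0 : 0 ≤ h) (h1 : h ≤ 1)
    {l i : ℕ} (hi : i ≤ l) {r : ℝ} (hr : 0 ≤ r) :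
    ‖iteratedDeriv i (fun r : ℝ => Complex.exp (-(c * h * r)) - 1 + c * h * r) r‖
      ≤ (3 * (1 + ‖c‖) ^ (l + 2) * h ^ 2) * (1 + r) ^ 2 := by
  have hc' : 0 ≤ (c * h).re := by simp; positivity
  have hnc := norm_nonneg c
  have hn : ‖c * (h : ℂ)‖ = ‖c‖ * h := by rw [norm_mul, Complex.norm_of_nonneg h0]
  have hre := re_neg_mul_ofReal_nonpos hc' hr
  have h3 : (1 : ℝ) ≤ (1 + r) ^ 2 := one_le_pow₀ (by linarith)
  have h4 : ‖c‖ ^ 2 ≤ (1 + ‖c‖) ^ (l + 2) :=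
    (pow_le_pow_left₀ (norm_nonneg _) (by linarith) _).trans
      (pow_le_pow_right₀ (by linarith) (by omega))
  rcases i with _ | _ | i
  · rw [iteratedDeriv_zero]
    have := norm_cexp_sub_one_sub_id_le hre
    rw [sub_neg_eq_add] at this
    refine this.trans ?_
    rw [norm_neg, norm_mul, hn, Complex.norm_of_nonneg hr]
    calc 3 * (‖c‖ * h * r) ^ 2 = 3 * ‖c‖ ^ 2 * h ^ 2 * r ^ 2 := by ring
      _ ≤ _ := by gcongr; linarith
  · rw [zero_add, iteratedDeriv_one, deriv_cexp_neg_mul_sub_one_add, norm_mul, norm_neg, hn]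
    have h5 : r ≤ (1 + r) ^ 2 := by nlinarith
    calc _ ≤ ‖c‖ * h * (2 * ‖-(c * h * r)‖) := by gcongr; exact norm_cexp_sub_one_le hre
      _ = 2 * ‖c‖ ^ 2 * h ^ 2 * r := by
        rw [norm_neg, norm_mul, hn, Complex.norm_of_nonneg hr]; ring
      _ ≤ _ := by gcongr; norm_num
  · rw [iteratedDeriv_cexp_neg_mul_sub_one_add, norm_mul, norm_pow, norm_neg, hn, mul_pow]
    have h4 : ‖c‖ ^ (i + 2) ≤ (1 + ‖c‖) ^ (l + 2) :=
      (pow_le_pow_left₀ (norm_nonneg _) (by linarith) _).trans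
        (pow_le_pow_right₀ (by linarith) (by omega))
    have h5 : h ^ (i + 2) ≤ h ^ 2 := by
      rw [pow_add]; exact mul_le_of_le_one_left (by positivity) (pow_le_one₀ h0 h1)
    have h6 : (0 : ℝ) ≤ (1 + ‖c‖) ^ (l + 2) * h ^ 2 := by positivity
    calc _ ≤ (1 + ‖c‖) ^ (l + 2) * h ^ 2 * 1 := by
          gcongr; exact norm_cexp_le_one hre
      _ ≤ (3 * (1 + ‖c‖) ^ (l + 2) * h ^ 2) * 1 := by linarith
      _ ≤ _ := by gcongr

end ExponentialMultiplier

/-! ### Complex Gaussians as Schwartz functions -/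

section Gaussian

open scoped ContDiff

variable {V : Type*} [NormedAddCommGroup V] [InnerProductSpace ℝ V]

theorem hasTemperateGrowth_gaussian {c : ℂ} (hc : 0 ≤ c.re) :
    Function.HasTemperateGrowth fun ξ : V => Complex.exp (-(c * ((‖ξ‖ ^ 2 : ℝ) : ℂ))) :=
  hasTemperateGrowth_radial (contDiff_cexp_neg_mul c) fun l =>
    ⟨(1 + ‖c‖) ^ l, fun _ hi _ hr => norm_iteratedDeriv_cexp_neg_mul_le hc hi hr⟩

theorem hasTemperateGrowth_ofReal_normSq :
    Function.HasTemperateGrowth fun ξ : V => ((‖ξ‖ ^ 2 : ℝ) : ℂ) :=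
  Function.HasTemperateGrowth.comp Function.Complex.hasTemperateGrowth_ofReal (Function.hasTemperateGrowth_norm_sq V)

theorem exists_pow_mul_exp_neg_le (k : ℕ) {a : ℝ} (ha : 0 < a) :
    ∃ C : ℝ, 0 ≤ C ∧ ∀ y : ℝ, 0 ≤ y → (1 + y) ^ k * Real.exp (-(a * y ^ 2)) ≤ C := by
  refine ⟨(k.factorial : ℝ) * Real.exp (1 + 1 / a), by positivity, fun y hy => ?_⟩
  have h1 : (1 + y) ^ k ≤ k.factorial * Real.exp (1 + y) := by
    have := Real.pow_div_factorial_le_exp (1 + y) (by positivity) k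
    rwa [div_le_iff₀' (by positivity)] at this
  calc _ ≤ (k.factorial * Real.exp (1 + y)) * Real.exp (-(a * y ^ 2)) := by gcongr
    _ = k.factorial * Real.exp (1 + y + -(a * y ^ 2)) := by rw [mul_assoc, ← Real.exp_add]
    _ ≤ _ := by
      have : y ≤ 1 / a + a * y ^ 2 := by
        have h2 : a * (1 / a) = 1 := by field_simp
        nlinarith [sq_nonneg (a * y - 1), sq_nonneg (a * y), mul_nonneg ha.le hy]
      have h3 : Real.exp (1 + y + -(a * y ^ 2)) ≤ Real.exp (1 + 1 / a) :=
        Real.exp_le_exp.2 (by linarith)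
      gcongr

/-- The Gaussian `e^{-c‖ξ‖²}` with `Re c > 0`, as a Schwartz function. -/
def gaussian (V : Type*) [NormedAddCommGroup V] [InnerProductSpace ℝ V] (c : ℂ) (hc : 0 < c.re) :
    𝓢(V, ℂ) where
  toFun := fun ξ => Complex.exp (-(c * ((‖ξ‖ ^ 2 : ℝ) : ℂ)))
  smooth' := (hasTemperateGrowth_gaussian hc.le).1
  decay' := fun k l => by
    obtain ⟨D, k', hD, H⟩ := exists_norm_iteratedFDeriv_comp_normSq_le V l
    obtain ⟨C, hC, hexp⟩ := exists_pow_mul_exp_neg_le (k + k') hc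
    refine ⟨D * (1 + ‖c‖) ^ l * C, fun x => ?_⟩
    have hx := norm_nonneg x
    have h1 := H _ x ((1 + ‖c‖) ^ l * Real.exp (-(c.re * ‖x‖ ^ 2))) (contDiff_cexp_neg_mul c)
      (fun i hi => by
        rw [iteratedDeriv_cexp_neg_mul, norm_mul, norm_pow, norm_neg, Complex.norm_exp]
        have h1 : ‖c‖ ^ i ≤ (1 + ‖c‖) ^ l :=
          (pow_le_pow_left₀ (norm_nonneg _) (by linarith) i).trans
            (pow_le_pow_right₀ (by linarith [norm_nonneg c]) hi)
        rw [Complex.neg_re, Complex.re_mul_ofReal]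
        gcongr) l le_rfl
    calc _ ≤ (1 + ‖x‖) ^ k * (D * ((1 + ‖c‖) ^ l * Real.exp (-(c.re * ‖x‖ ^ 2)))
          * (1 + ‖x‖) ^ k') := by
          gcongr
          linarith
      _ = D * (1 + ‖c‖) ^ l * ((1 + ‖x‖) ^ (k + k') * Real.exp (-(c.re * ‖x‖ ^ 2))) := by ring
      _ ≤ _ := by
        gcongr
        exact hexp _ hx

theorem gaussian_apply {c : ℂ} (hc : 0 < c.re) (ξ : V) :
    gaussian V c hc ξ = Complex.exp (-(c * ((‖ξ‖ ^ 2 : ℝ) : ℂ))) := rfl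

end Gaussian

/-! ### Uniqueness for `T' = -c‖ξ‖² T` in tempered distributions -/

section Uniqueness

open scoped ContDiff

variable {V : Type*} [NormedAddCommGroup V] [InnerProductSpace ℝ V]

/-- Multiplication by `e^{-cs‖ξ‖²}`. -/
def expMul (c : ℂ) (s : ℝ) : 𝓢(V, ℂ) →L[ℂ] 𝓢(V, ℂ) :=
  SchwartzMap.smulLeftCLM ℂ fun ξ : V => Complex.exp (-(c * s * ((‖ξ‖ ^ 2 : ℝ) : ℂ)))

/-- Multiplication by `‖ξ‖²`. -/
def normSqMul : 𝓢(V, ℂ) →L[ℂ] 𝓢(V, ℂ) :=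
  SchwartzMap.smulLeftCLM ℂ fun ξ : V => ((‖ξ‖ ^ 2 : ℝ) : ℂ)

theorem normSqMul_apply (φ : 𝓢(V, ℂ)) (ξ : V) :
    normSqMul φ ξ = ((‖ξ‖ ^ 2 : ℝ) : ℂ) * φ ξ := by
  rw [normSqMul, SchwartzMap.smulLeftCLM_apply_apply hasTemperateGrowth_ofReal_normSq, smul_eq_mul]

variable {c : ℂ} (hc : 0 ≤ c.re)
include hc

theorem re_mul_ofReal_nonneg {s : ℝ} (hs : 0 ≤ s) : 0 ≤ (c * s).re := by
  rw [Complex.re_mul_ofReal]; positivity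

theorem expMul_apply {s : ℝ} (hs : 0 ≤ s) (φ : 𝓢(V, ℂ)) (ξ : V) :
    expMul c s φ ξ = Complex.exp (-(c * s * ((‖ξ‖ ^ 2 : ℝ) : ℂ))) * φ ξ := by
  rw [expMul, SchwartzMap.smulLeftCLM_apply_apply
    (hasTemperateGrowth_gaussian (re_mul_ofReal_nonneg hc hs)), smul_eq_mul]

theorem expMul_add {s h : ℝ} (hs : 0 ≤ s) (hh : 0 ≤ h) (φ : 𝓢(V, ℂ)) :
    expMul c (s + h) φ = expMul c h (expMul c s φ) := by
  ext ξ
  rw [expMul_apply hc (add_nonneg hs hh), expMul_apply hc hh, expMul_apply hc hs, ← mul_assoc,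
    ← Complex.exp_add]
  congr 2
  push_cast
  ring

theorem exists_supSeminorm_expMul_sub_le (m : ℕ × ℕ) :
    ∃ (K : ℝ) (m' : ℕ × ℕ), 0 ≤ K ∧ ∀ h : ℝ, 0 ≤ h → h ≤ 1 → ∀ φ : 𝓢(V, ℂ),
      supSeminorm m (expMul c h φ - φ) ≤ K * h * supSeminorm m' φ := by
  obtain ⟨K, m', hK, H⟩ := exists_supSeminorm_smulLeft_radial_le (V := V) m
  refine ⟨2 * (1 + ‖c‖) ^ (m.2 + 1) * K, m', by positivity, fun h h0 h1 φ => ?_⟩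
  have htemp : Function.HasTemperateGrowth
      fun ξ : V => Complex.exp (-(c * h * ((‖ξ‖ ^ 2 : ℝ) : ℂ))) - 1 :=
    (hasTemperateGrowth_gaussian (re_mul_ofReal_nonneg hc h0)).sub (.const 1)
  have := H (fun r => Complex.exp (-(c * h * r)) - 1) _
    ((contDiff_cexp_neg_mul (c * h)).sub contDiff_const) htemp
    (fun i hi r hr => norm_iteratedDeriv_cexp_neg_mul_sub_one_le hc h0 h1 hi hr) φ
  have heq : expMul c h φ - φ = SchwartzMap.smulLeftCLM ℂ
      (fun ξ : V => Complex.exp (-(c * h * ((‖ξ‖ ^ 2 : ℝ) : ℂ))) - 1) φ := by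
    ext ξ
    rw [SchwartzMap.smulLeftCLM_apply_apply htemp, sub_apply, expMul_apply hc h0,
      smul_eq_mul]
    ring
  rw [heq]
  refine this.trans (le_of_eq ?_)
  ring

/-- The semigroup is differentiable at zero in the Schwartz topology, with a quadratic error.
Quantitative control is needed because the remainder is paired with a functional that itself moves
in time. -/
theorem exists_supSeminorm_expMul_sub_add_le (m : ℕ × ℕ) :
    ∃ (K : ℝ) (m' : ℕ × ℕ), 0 ≤ K ∧ ∀ h : ℝ, 0 ≤ h → h ≤ 1 → ∀ φ : 𝓢(V, ℂ),
      supSeminorm m (expMul c h φ - φ + (c * h) • normSqMul φ) ≤ K * h ^ 2 * supSeminorm m' φ := by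
  obtain ⟨K, m', hK, H⟩ := exists_supSeminorm_smulLeft_radial_le (V := V) m
  refine ⟨3 * (1 + ‖c‖) ^ (m.2 + 2) * K, m', by positivity, fun h h0 h1 φ => ?_⟩
  have htemp : Function.HasTemperateGrowth
      fun ξ : V => Complex.exp (-(c * h * ((‖ξ‖ ^ 2 : ℝ) : ℂ))) - 1
        + c * h * ((‖ξ‖ ^ 2 : ℝ) : ℂ) :=
    ((hasTemperateGrowth_gaussian (re_mul_ofReal_nonneg hc h0)).sub (.const 1)).add
      ((Function.HasTemperateGrowth.const (c * h)).mul hasTemperateGrowth_ofReal_normSq)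
  have := H (fun r => Complex.exp (-(c * h * r)) - 1 + c * h * r) _
    (((contDiff_cexp_neg_mul (c * h)).sub contDiff_const).add
      (contDiff_const.mul Complex.ofRealCLM.contDiff)) htemp
    (fun i hi r hr => norm_iteratedDeriv_cexp_neg_mul_sub_one_add_le hc h0 h1 hi hr) φ
  have heq : expMul c h φ - φ + (c * h) • normSqMul φ = SchwartzMap.smulLeftCLM ℂ
      (fun ξ : V => Complex.exp (-(c * h * ((‖ξ‖ ^ 2 : ℝ) : ℂ))) - 1
        + c * h * ((‖ξ‖ ^ 2 : ℝ) : ℂ)) φ := by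
    ext ξ
    rw [SchwartzMap.smulLeftCLM_apply_apply htemp, add_apply, sub_apply,
      smul_apply, expMul_apply hc h0, normSqMul_apply, smul_eq_mul, smul_eq_mul]
    ring
  rw [heq]
  refine this.trans (le_of_eq ?_)
  ring

theorem exists_supSeminorm_expMul_le (m : ℕ × ℕ) {t : ℝ} (ht : 0 ≤ t) :
    ∃ (K : ℝ) (m' : ℕ × ℕ), 0 ≤ K ∧ ∀ s : ℝ, 0 ≤ s → s ≤ t → ∀ φ : 𝓢(V, ℂ),
      supSeminorm m (expMul c s φ) ≤ K * supSeminorm m' φ := by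
  obtain ⟨K, m', hK, H⟩ := exists_supSeminorm_smulLeft_radial_le (V := V) m
  refine ⟨(1 + ‖c‖ * t) ^ m.2 * K, m', by positivity, fun s h0 h1 φ => ?_⟩
  have hcs := re_mul_ofReal_nonneg hc h0
  refine H _ _ (contDiff_cexp_neg_mul (c * s)) (hasTemperateGrowth_gaussian hcs)
    (fun i hi r hr => (norm_iteratedDeriv_cexp_neg_mul_le hcs hi hr).trans ?_) φ
  rw [norm_mul, Complex.norm_of_nonneg h0]
  gcongr

theorem exists_supSeminorm_expMul_sub_expMul_le (m : ℕ × ℕ) {t : ℝ} (ht : 0 ≤ t) (φ : 𝓢(V, ℂ)) :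
    ∃ L : ℝ, 0 ≤ L ∧ ∀ s s' : ℝ, 0 ≤ s → s ≤ t → 0 ≤ s' → s' ≤ t → |s' - s| ≤ 1 →
      supSeminorm m (expMul c s' φ - expMul c s φ) ≤ L * |s' - s| := by
  obtain ⟨K, m', hK, H⟩ := exists_supSeminorm_expMul_sub_le (V := V) hc m
  obtain ⟨K', m'', hK', H'⟩ := exists_supSeminorm_expMul_le (V := V) hc m' ht
  have key : ∀ s s' : ℝ, 0 ≤ s → s ≤ t → s ≤ s' → |s' - s| ≤ 1 →
      supSeminorm m (expMul c s' φ - expMul c s φ)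
        ≤ K * (K' * supSeminorm m'' φ) * |s' - s| := by
    intro s s' hs hst hss h1
    have hh : 0 ≤ s' - s := sub_nonneg.2 hss
    rw [abs_of_nonneg hh] at h1 ⊢
    have e : expMul c s' φ = expMul c (s' - s) (expMul c s φ) := by
      rw [← expMul_add hc hs hh]; congr; ring
    rw [e]
    refine (H _ hh h1 _).trans ?_
    calc _ ≤ K * (s' - s) * (K' * supSeminorm m'' φ) := by gcongr; exact H' s hs hst φ
      _ = _ := by ring
  refine ⟨K * (K' * supSeminorm m'' φ), mul_nonneg hK (mul_nonneg hK' (apply_nonneg _ _)),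
    fun s s' hs hst hs' hst' h1 => ?_⟩
  rcases le_total s s' with h | h
  · exact key s s' hs hst h h1
  · rw [map_sub_rev, abs_sub_comm]
    exact key s' s hs' hst' h (by rwa [abs_sub_comm])

/-- Weakly continuous solutions of `T' = -c‖ξ‖² T` in the tempered distributions are unique. -/
theorem eq_expMul_of_hasDerivAt (T : ℝ → 𝓢(V, ℂ) →L[ℂ] ℂ)
    (hcont : ∀ ψ, ContinuousOn (fun t => T t ψ) (Set.Ici 0))
    (hderiv : ∀ ψ t, 0 < t → HasDerivAt (fun τ => T τ ψ) (-c * T t (normSqMul ψ)) t)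
    {t : ℝ} (ht : 0 ≤ t) (ψ : 𝓢(V, ℂ)) : T t ψ = T 0 (expMul c t ψ) := by
  -- Weak continuity bounds `T τ φ` on the compact time interval for each `φ`; uniform boundedness
  -- turns this into one seminorm estimate valid for all `τ ∈ [0, t]`.
  obtain ⟨m, C, hC, hT⟩ := exists_seminorm_bound_of_pointwise_bounded
    (fun τ : Set.Icc (0 : ℝ) t => T τ) (fun φ => by
      obtain ⟨M, hM⟩ := isCompact_Icc.exists_bound_of_continuousOn
        ((hcont φ).mono (Set.Icc_subset_Ici_self : Set.Icc 0 t ⊆ _))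
      exact ⟨M, fun i => hM i i.2⟩)
  replace hT : ∀ τ, 0 ≤ τ → τ ≤ t → ∀ φ, ‖T τ φ‖ ≤ C * supSeminorm m φ :=
    fun τ h0 h1 φ => hT ⟨τ, h0, h1⟩ φ
  have hMsub : ∀ φ : 𝓢(V, ℂ), ContinuousOn (fun s' => T (t - s') φ) (Set.Icc 0 t) := by
    intro φ
    refine (hcont φ).comp (by fun_prop) fun s' hs' => ?_
    simpa using hs'.2
  have hc0 : ContinuousOn (fun s => T (t - s) (expMul c s ψ)) (Set.Icc 0 t) := by
    obtain ⟨L, hL, HL⟩ := exists_supSeminorm_expMul_sub_expMul_le (V := V) hc m ht ψ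
    intro s hs
    have h1 : Tendsto (fun s' => T (t - s') (expMul c s ψ)) (𝓝[Set.Icc 0 t] s)
        (𝓝 (T (t - s) (expMul c s ψ))) := hMsub _ s hs
    have h2 : Tendsto (fun s' => T (t - s') (expMul c s' ψ - expMul c s ψ)) (𝓝[Set.Icc 0 t] s)
        (𝓝 0) := by
      refine squeeze_zero_norm' (a := fun s' => C * (L * |s' - s|)) ?_ ?_
      · have hball : ∀ᶠ s' in 𝓝[Set.Icc 0 t] s, |s' - s| < 1 := by
          refine nhdsWithin_le_nhds ?_
          filter_upwards [Metric.ball_mem_nhds s one_pos] with s' hs'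
          simpa [Real.dist_eq] using hs'
        filter_upwards [hball, self_mem_nhdsWithin] with s' hs' hs'm
        refine (hT (t - s') (by linarith [hs'm.2]) (by linarith [hs'm.1]) _).trans ?_
        gcongr
        exact HL s s' hs.1 hs.2 hs'm.1 hs'm.2 hs'.le
      · have : Continuous fun s' : ℝ => C * (L * |s' - s|) := by fun_prop
        have h := this.tendsto s
        simp only [sub_self, abs_zero, mul_zero] at h
        exact h.mono_left nhdsWithin_le_nhds
    have h3 := h1.add h2
    rw [add_zero] at h3
    refine h3.congr fun s' => ?_
    rw [← map_add]; congr 1; abel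
  -- Only the right derivative is taken, since `expMul` is a forward semigroup, and only for `s <
  -- t`, where `t - s > 0` and the equation holds.
  have hd0 : ∀ s ∈ Set.Ico 0 t, HasDerivWithinAt (fun s => T (t - s) (expMul c s ψ)) 0
      (Set.Ici s) s := by
    intro s hs
    obtain ⟨K, m', hK, HK⟩ := exists_supSeminorm_expMul_sub_add_le (V := V) hc m
    set φ := expMul c s ψ with hφ
    have hτ : 0 < t - s := sub_pos.2 hs.2
    -- The increment splits into three parts: the test function frozen at `s` (`hA`), the linear
    -- term of the semigroup expansion (`hB`) and a quadratic remainder (`hD`). The first two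
    -- derivatives cancel and the third is zero.
    have hA : ∀ χ, HasDerivAt (fun s' => T (t - s') χ) (c * T (t - s) (normSqMul χ)) s := by
      intro χ
      have h := (hderiv χ (t - s) hτ).scomp s ((hasDerivAt_id s).const_sub t)
      refine h.congr_deriv ?_
      rw [neg_one_smul]; ring
    have hB : HasDerivAt (fun s' : ℝ => ((s' - s : ℝ) : ℂ) * (-c * T (t - s') (normSqMul φ)))
        (-c * T (t - s) (normSqMul φ)) s := by
      have h1 : HasDerivAt (fun s' : ℝ => ((s' - s : ℝ) : ℂ)) 1 s :=
        ((hasDerivAt_id s).sub_const s).ofReal_comp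
      refine (h1.mul ((hA (normSqMul φ)).const_mul (-c))).congr_deriv ?_
      simp
    have hD : HasDerivWithinAt
        (fun s' => T (t - s') (expMul c s' ψ - φ + (c * (s' - s : ℝ)) • normSqMul φ)) 0
        (Set.Ici s) s := by
      have hO : (fun s' => T (t - s') (expMul c s' ψ - φ + (c * (s' - s : ℝ)) • normSqMul φ))
          =O[𝓝[Set.Ici s] s] fun s' => ‖s' - s‖ ^ 2 := by
        refine Asymptotics.IsBigO.of_bound (C * (K * supSeminorm m' φ)) ?_
        have hlt : ∀ᶠ s' in 𝓝[Set.Ici s] s, s' < min t (s + 1) :=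
          nhdsWithin_le_nhds (Iio_mem_nhds (lt_min hs.2 (by linarith)))
        filter_upwards [hlt, self_mem_nhdsWithin] with s' hs' hs'm
        have hss : s ≤ s' := hs'm
        have h0 : 0 ≤ s' - s := sub_nonneg.2 hss
        have h1 : s' - s ≤ 1 := by linarith [hs'.le.trans (min_le_right _ _)]
        have h2 : s' ≤ t := hs'.le.trans (min_le_left _ _)
        have e : expMul c s' ψ = expMul c (s' - s) φ := by
          rw [hφ, ← expMul_add hc hs.1 h0]; congr; ring
        rw [e]
        refine (hT (t - s') (by linarith) (by linarith [hs.1]) _).trans ?_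
        calc _ ≤ C * (K * (s' - s) ^ 2 * supSeminorm m' φ) := by gcongr; exact HK _ h0 h1 φ
          _ = _ := by
            rw [norm_pow, norm_norm, Real.norm_of_nonneg h0]; ring
      have := Asymptotics.IsBigO.hasFDerivWithinAt (𝕜 := ℝ) hO Set.self_mem_Ici (by norm_num)
      simpa using this.hasDerivWithinAt
    have hsum := ((hA φ).hasDerivWithinAt (s := Set.Ici s)).add
      ((hB.hasDerivWithinAt (s := Set.Ici s)).add hD)
    refine (hsum.congr_deriv (by ring)).congr_of_eventuallyEq (Eventually.of_forall fun s' => ?_) ?_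
    all_goals
      simp only [Pi.add_apply, map_add, map_sub, map_smul, smul_eq_mul]
      ring
  have := constant_of_has_deriv_right_zero hc0 hd0 t ⟨ht, le_rfl⟩
  have e0 : expMul c 0 ψ = ψ := by
    ext ξ
    rw [expMul_apply hc le_rfl]; simp
  simp only [sub_self, sub_zero, e0] at this
  exact this.symm

end Uniqueness

/-! ### Inverse Fourier transforms: scaling, convolution and `L¹` bounds -/

section InverseFourier

theorem coe_fourierChar_inner_sub {V : Type*} [NormedAddCommGroup V] [InnerProductSpace ℝ V]
    (ξ x y : V) :
    ((Real.fourierChar ⟪ξ, x - y⟫ : Circle) : ℂ)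
      = ((Real.fourierChar ⟪ξ, x⟫ : Circle) : ℂ) * ((Real.fourierChar (-⟪y, ξ⟫) : Circle) : ℂ) := by
  rw [inner_sub_right, sub_eq_add_neg, AddChar.map_add_eq_mul, Circle.coe_mul, real_inner_comm ξ y]

variable {V : Type*} [NormedAddCommGroup V] [InnerProductSpace ℝ V] [FiniteDimensional ℝ V]
  [MeasurableSpace V] [BorelSpace V]

theorem norm_fourierInv_le (k : V → ℂ) (x : V) : ‖𝓕⁻ k x‖ ≤ ∫ ξ, ‖k ξ‖ := by
  rw [Real.fourierInv_eq_fourier_neg]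
  exact VectorFourier.norm_fourierIntegral_le_integral_norm _ _ _ _ _

theorem continuous_fourierInv {k : V → ℂ} (hk : Integrable k) : Continuous (𝓕⁻ k) := by
  have h : Continuous (𝓕 k) :=
    VectorFourier.fourierIntegral_continuous Real.continuous_fourierChar continuous_inner hk
  have e : 𝓕⁻ k = fun x => 𝓕 k (-x) := funext fun x => Real.fourierInv_eq_fourier_neg k x
  rw [e]
  exact h.comp continuous_neg

theorem fourierInv_even {k : V → ℂ} (hk : ∀ ξ, k (-ξ) = k ξ) (x : V) : 𝓕⁻ k (-x) = 𝓕⁻ k x := by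
  rw [Real.fourierInv_eq_fourier_neg, neg_neg, Real.fourierInv_eq_fourier_comp_neg]
  simp only [hk]

theorem fourierInv_comp_smul (k : V → ℂ) {a : ℝ} (ha : 0 < a) (x : V) :
    𝓕⁻ (fun ξ => k (a • ξ)) x = (((a ^ Module.finrank ℝ V)⁻¹ : ℝ) : ℂ) * 𝓕⁻ k (a⁻¹ • x) := by
  rw [Real.fourierInv_eq, Real.fourierInv_eq]
  have h := Measure.integral_comp_smul volume
    (fun ξ : V => Real.fourierChar ⟪ξ, a⁻¹ • x⟫ • k ξ) a
  rw [abs_of_pos (by positivity), Complex.real_smul] at h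
  rw [← h]
  refine integral_congr_ae (Eventually.of_forall fun ξ => ?_)
  simp only [inner_smul_left, inner_smul_right, conj_trivial]
  rw [← mul_assoc, inv_mul_cancel₀ ha.ne', one_mul]

theorem fourierInv_const_mul (c : ℂ) (k : V → ℂ) (x : V) :
    𝓕⁻ (fun ξ => c * k ξ) x = c * 𝓕⁻ k x := by
  rw [Real.fourierInv_eq, Real.fourierInv_eq, ← integral_const_mul]
  refine integral_congr_ae (Eventually.of_forall fun ξ => ?_)
  simp only [Circle.smul_def, smul_eq_mul]
  ring

/-- Dilating the symbol dilates the kernel inversely and preserves its mass, so `L¹` bounds on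
dilated symbols are uniform in the dilation. -/
theorem lintegral_enorm_fourierInv_comp_smul (k : V → ℂ) {a : ℝ} (ha : 0 < a) :
    ∫⁻ x, ‖𝓕⁻ (fun ξ => k (a • ξ)) x‖ₑ = ∫⁻ x, ‖𝓕⁻ k x‖ₑ := by
  have hd : 0 < (a ^ Module.finrank ℝ V)⁻¹ := by positivity
  simp_rw [fourierInv_comp_smul k ha, enorm_mul]
  rw [lintegral_const_mul' _ _ enorm_ne_top]
  let e : V ≃ᵐ V := (Homeomorph.smulOfNeZero (a⁻¹) (inv_ne_zero ha.ne')).toMeasurableEquiv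
  have h1 : ∫⁻ x, ‖𝓕⁻ k (a⁻¹ • x)‖ₑ = ∫⁻ x, ‖𝓕⁻ k x‖ₑ ∂(Measure.map (fun x : V => a⁻¹ • x) volume) :=
    (lintegral_map_equiv (fun x => ‖𝓕⁻ k x‖ₑ) e).symm
  rw [h1, Measure.map_addHaar_smul volume (inv_ne_zero ha.ne'), lintegral_smul_measure, smul_eq_mul,
    ← mul_assoc, inv_pow, inv_inv, abs_of_pos (by positivity)]
  have h2 : ‖(((a ^ Module.finrank ℝ V)⁻¹ : ℝ) : ℂ)‖ₑ = ENNReal.ofReal (a ^ Module.finrank ℝ V)⁻¹ := by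
    rw [← ofReal_norm, Complex.norm_of_nonneg hd.le]
  rw [h2, ← ENNReal.ofReal_mul hd.le, inv_mul_cancel₀ (by positivity), ENNReal.ofReal_one, one_mul]

theorem integral_fourierInv_sub_mul {k ψ : V → ℂ} (hk : Integrable k) (hψ : Integrable ψ) (x : V) :
    ∫ y, 𝓕⁻ k (x - y) * ψ y = 𝓕⁻ (fun ξ => k ξ * 𝓕 ψ ξ) x := by
  have hint : Integrable (fun p : V × V =>
      ((Real.fourierChar ⟪p.2, x - p.1⟫ : Circle) : ℂ) * (ψ p.1 * k p.2)) (volume.prod volume) := by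
    refine (hψ.mul_prod hk).bdd_mul (c := 1) ?_ (Eventually.of_forall fun p => (Circle.norm_coe _).le)
    have : Continuous fun p : V × V => ((Real.fourierChar ⟪p.2, x - p.1⟫ : Circle) : ℂ) :=
      continuous_subtype_val.comp (Real.continuous_fourierChar.comp (by fun_prop))
    exact this.aestronglyMeasurable
  have h1 : ∀ y, 𝓕⁻ k (x - y) * ψ y
      = ∫ ξ, ((Real.fourierChar ⟪ξ, x - y⟫ : Circle) : ℂ) * (ψ y * k ξ) := by
    intro y
    rw [Real.fourierInv_eq, ← integral_mul_const]
    refine integral_congr_ae (Eventually.of_forall fun ξ => ?_)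
    simp only [Circle.smul_def, smul_eq_mul]
    ring
  simp_rw [h1]
  rw [integral_integral_swap hint, Real.fourierInv_eq]
  refine integral_congr_ae (Eventually.of_forall fun ξ => ?_)
  simp only [Circle.smul_def, smul_eq_mul, Real.fourier_eq]
  rw [← integral_const_mul, ← integral_const_mul]
  refine integral_congr_ae (Eventually.of_forall fun y => ?_)
  beta_reduce
  rw [coe_fourierChar_inner_sub]
  ring

theorem lintegral_lintegral_sub_mul {h g : V → ℝ≥0∞} (hh : AEMeasurable h) (hg : AEMeasurable g) :
    ∫⁻ x, ∫⁻ y, h (x - y) * g y = (∫⁻ x, h x) * ∫⁻ x, g x := by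
  have hm : AEMeasurable (fun p : V × V => h (p.1 - p.2) * g p.2) (volume.prod volume) :=
    (hh.comp_quasiMeasurePreserving
      (quasiMeasurePreserving_sub_of_right_invariant volume volume)).mul
      (hg.comp_quasiMeasurePreserving Measure.quasiMeasurePreserving_snd)
  calc _ = ∫⁻ y, ∫⁻ x, h (x - y) * g y := lintegral_lintegral_swap hm
    _ = ∫⁻ y, (∫⁻ x, h x) * g y := by
        refine lintegral_congr fun y => ?_
        have hy : AEMeasurable (fun x => h (x - y)) := hh.comp_quasiMeasurePreserving
          (measurePreserving_sub_right volume y).quasiMeasurePreserving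
        rw [lintegral_mul_const'' _ hy, lintegral_sub_right_eq_self h y]
    _ = _ := lintegral_const_mul'' _ hg

/-- Young's inequality `‖H * ψ‖₁ ≤ ‖H‖₁ ‖ψ‖₁`. -/
theorem lintegral_enorm_conv_le {H ψ : V → ℂ} (hH : AEMeasurable H) (hψ : AEMeasurable ψ) :
    ∫⁻ x, ‖∫ y, H (x - y) * ψ y‖ₑ ≤ (∫⁻ x, ‖H x‖ₑ) * ∫⁻ x, ‖ψ x‖ₑ := by
  rw [← lintegral_lintegral_sub_mul hH.enorm hψ.enorm]
  refine lintegral_mono fun x => (enorm_integral_le_lintegral_enorm _).trans (le_of_eq ?_)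
  simp_rw [enorm_mul]

/-- A product of symbols is a convolution of kernels, so the `L¹` norm of the inverse transform is
submultiplicative. -/
theorem lintegral_enorm_fourierInv_mul_le {k : V → ℂ} (hk : Integrable k) (ψ : 𝓢(V, ℂ)) :
    ∫⁻ x, ‖𝓕⁻ (fun ξ => k ξ * ψ ξ) x‖ₑ ≤ (∫⁻ x, ‖𝓕⁻ k x‖ₑ) * ∫⁻ x, ‖(𝓕⁻ ψ) x‖ₑ := by
  have h : ∀ x, 𝓕⁻ (fun ξ => k ξ * ψ ξ) x = ∫ y, 𝓕⁻ k (x - y) * (𝓕⁻ ψ) y := by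
    intro x
    rw [integral_fourierInv_sub_mul hk (𝓕⁻ ψ).integrable, ← SchwartzMap.fourier_coe,
      FourierTransform.fourier_fourierInv_eq]
  simp_rw [h]
  exact lintegral_enorm_conv_le (continuous_fourierInv hk).measurable.aemeasurable
    (𝓕⁻ ψ).continuous.measurable.aemeasurable

end InverseFourier

/-! ### Integrability of `|D|^s φ` through the heat semigroup -/

section RieszSymbol

theorem integrableOn_mul_exp_mul_rpow {α R : ℝ} (hα1 : α < 1) (hR : 0 ≤ R) :
    IntegrableOn (fun τ : ℝ => R * Real.exp (-(R * τ)) * τ ^ (-α)) (Set.Ioi 0) := by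
  rcases hR.eq_or_lt with rfl | hR
  · simp
  have h := Real.integral_rpow_mul_exp_neg_mul_Ioi (a := 1 - α) (r := R) (by linarith) hR
  have h1 : IntegrableOn (fun τ : ℝ => τ ^ (1 - α - 1) * Real.exp (-(R * τ))) (Set.Ioi 0) := by
    refine Integrable.of_integral_ne_zero ?_
    rw [h]
    have := Real.Gamma_pos_of_pos (show 0 < 1 - α by linarith)
    positivity
  refine (h1.const_mul R).congr (Eventually.of_forall fun τ => ?_)
  simp only [show 1 - α - 1 = -α by ring]
  ring

/-- A rescaled Gamma integral. It writes the fractional power `R ^ α` as a superposition of `R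
e^{-Rτ}`, whose multipliers are smooth. -/
theorem integral_mul_exp_mul_rpow {α R : ℝ} (hα : 0 < α) (hα1 : α < 1) (hR : 0 ≤ R) :
    ∫ τ in Set.Ioi 0, R * Real.exp (-(R * τ)) * τ ^ (-α) = Real.Gamma (1 - α) * R ^ α := by
  rcases hR.eq_or_lt with rfl | hR
  · simp [Real.zero_rpow hα.ne']
  have h := Real.integral_rpow_mul_exp_neg_mul_Ioi (a := 1 - α) (r := R) (by linarith) hR
  calc _ = ∫ τ in Set.Ioi 0, R * (τ ^ (1 - α - 1) * Real.exp (-(R * τ))) := by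
        refine integral_congr_ae (Eventually.of_forall fun τ => ?_)
        simp only [show 1 - α - 1 = -α by ring]
        ring
    _ = R * ((1 / R) ^ (1 - α) * Real.Gamma (1 - α)) := by rw [integral_const_mul, h]
    _ = Real.Gamma (1 - α) * (R * R ^ (-(1 - α))) := by
        rw [one_div, Real.inv_rpow hR.le, ← Real.rpow_neg hR.le]; ring
    _ = _ := by
        rw [← Real.rpow_one_add' hR.le (by linarith [hα.ne'])]
        ring_nf

section Symbol

variable {V : Type*} [NormedAddCommGroup V]

/-- The symbol of `-Δ`. -/
def lapSymbol (ξ : V) : ℝ := (2 * Real.pi * ‖ξ‖) ^ 2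

theorem continuous_lapSymbol : Continuous (lapSymbol : V → ℝ) := by
  unfold lapSymbol; fun_prop

theorem lapSymbol_nonneg (ξ : V) : 0 ≤ lapSymbol ξ := sq_nonneg _

theorem lapSymbol_smul [NormedSpace ℝ V] (a : ℝ) (ξ : V) : lapSymbol (a • ξ) = a ^ 2 * lapSymbol ξ := by
  rw [lapSymbol, lapSymbol, norm_smul, mul_pow, mul_pow, mul_pow, Real.norm_eq_abs, sq_abs]; ring

variable [InnerProductSpace ℝ V]

/-- Multiplication by the symbol of `-Δ`. -/
def lapSymbolMul : 𝓢(V, ℂ) →L[ℂ] 𝓢(V, ℂ) := (((2 * Real.pi) ^ 2 : ℝ) : ℂ) • normSqMul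

theorem lapSymbolMul_apply (ψ : 𝓢(V, ℂ)) (ξ : V) :
    lapSymbolMul ψ ξ = (lapSymbol ξ : ℂ) * ψ ξ := by
  rw [lapSymbolMul, smul_apply, smul_apply, normSqMul_apply, lapSymbol, smul_eq_mul]
  push_cast
  ring

variable (V) in
theorem exists_schwartz_exp_neg_lapSymbol :
    ∃ g : 𝓢(V, ℂ), ∀ ξ, g ξ = (Real.exp (-lapSymbol ξ) : ℂ) := by
  have h : 0 < ((((2 * Real.pi) ^ 2 : ℝ) : ℂ)).re := by
    rw [Complex.ofReal_re]; positivity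
  refine ⟨gaussian V _ h, fun ξ => ?_⟩
  rw [gaussian_apply, lapSymbol]
  push_cast
  congr 1
  ring

theorem lapSymbolMul_iterate_apply (j : ℕ) (ψ : 𝓢(V, ℂ)) (ξ : V) :
    (lapSymbolMul^[j] ψ) ξ = ((lapSymbol ξ ^ j : ℝ) : ℂ) * ψ ξ := by
  induction j with
  | zero => simp
  | succ j ih =>
    rw [Function.iterate_succ_apply', lapSymbolMul_apply, ih]
    push_cast
    ring

end Symbol

variable {V : Type*} [NormedAddCommGroup V] [InnerProductSpace ℝ V] [FiniteDimensional ℝ V]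
  [MeasurableSpace V] [BorelSpace V]

theorem integrable_rpow_mul_schwartz {s : ℝ} (hs : 0 ≤ s) (ψ : 𝓢(V, ℂ)) :
    Integrable fun ξ : V => (((2 * Real.pi * ‖ξ‖) ^ s : ℝ) : ℂ) * ψ ξ := by
  obtain ⟨N, hN⟩ := exists_nat_ge s
  have hdom : Integrable fun ξ : V => ‖ψ ξ‖ + (2 * Real.pi) ^ N * (‖ξ‖ ^ N * ‖ψ ξ‖) :=
    ψ.integrable.norm.add ((ψ.integrable_pow_mul volume N).const_mul _)
  have hcont : Continuous fun ξ : V => (((2 * Real.pi * ‖ξ‖) ^ s : ℝ) : ℂ) * ψ ξ :=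
    (Complex.continuous_ofReal.comp ((by fun_prop : Continuous fun ξ : V =>
      2 * Real.pi * ‖ξ‖).rpow_const fun _ => Or.inr hs)).mul ψ.continuous
  refine hdom.mono' hcont.aestronglyMeasurable (Eventually.of_forall fun ξ => ?_)
  have h0 : 0 ≤ 2 * Real.pi * ‖ξ‖ := by positivity
  rw [norm_mul, Complex.norm_of_nonneg (Real.rpow_nonneg h0 s)]
  have h1 : (2 * Real.pi * ‖ξ‖) ^ s ≤ 1 + (2 * Real.pi * ‖ξ‖) ^ N := by
    rcases le_total (2 * Real.pi * ‖ξ‖) 1 with h | h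
    · exact (Real.rpow_le_one h0 h hs).trans (by simp; positivity)
    · refine (Real.rpow_le_rpow_of_exponent_le h hN).trans ?_
      rw [Real.rpow_natCast]; linarith
  calc _ ≤ (1 + (2 * Real.pi * ‖ξ‖) ^ N) * ‖ψ ξ‖ := by gcongr
    _ = _ := by rw [mul_pow]; ring

/-- The constant bound is used on `(0, 1]`, where `α < 1` gives integrability, and the `τ⁻¹` bound
on `(1, ∞)`, where `α > 0` does. -/
theorem lintegral_rpow_mul_min_lt_top {α : ℝ} (hα : 0 < α) (hα1 : α < 1) {A B : ℝ≥0∞}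
    (hA : A ≠ ∞) (hB : B ≠ ∞) {b : ℝ → ℝ≥0∞}
    (hbA : ∀ τ, 0 < τ → b τ ≤ ENNReal.ofReal τ⁻¹ * A) (hbB : ∀ τ, 0 < τ → b τ ≤ B) :
    ∫⁻ τ in Set.Ioi 0, ENNReal.ofReal (τ ^ (-α)) * b τ < ∞ := by
  rw [← Set.Ioc_union_Ioi_eq_Ioi zero_le_one]
  refine (lintegral_union_le _ _ _).trans_lt (ENNReal.add_lt_top.2 ⟨?_, ?_⟩)
  · have h1 : IntegrableOn (fun τ : ℝ => τ ^ (-α)) (Set.Ioc 0 1) :=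
      (intervalIntegrable_iff_integrableOn_Ioc_of_le zero_le_one).1
        (intervalIntegral.intervalIntegrable_rpow' (by linarith))
    calc _ ≤ ∫⁻ τ in Set.Ioc (0 : ℝ) 1, ENNReal.ofReal (τ ^ (-α)) * B :=
          setLIntegral_mono_ae' measurableSet_Ioc (Eventually.of_forall fun τ hτ => by
            gcongr; exact hbB τ hτ.1)
      _ = (∫⁻ τ in Set.Ioc (0 : ℝ) 1, ENNReal.ofReal (τ ^ (-α))) * B := lintegral_mul_const' _ _ hB
      _ < ∞ := ENNReal.mul_lt_top h1.lintegral_lt_top hB.lt_top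
  · have h1 : IntegrableOn (fun τ : ℝ => τ ^ (-α - 1)) (Set.Ioi 1) :=
      integrableOn_Ioi_rpow_of_lt (by linarith) one_pos
    calc _ ≤ ∫⁻ τ in Set.Ioi (1 : ℝ), ENNReal.ofReal (τ ^ (-α - 1)) * A := by
          refine setLIntegral_mono_ae' measurableSet_Ioi (Eventually.of_forall fun τ hτ => ?_)
          have hτ0 : (0 : ℝ) < τ := one_pos.trans hτ
          refine (mul_le_mul_right (hbA τ hτ0) _).trans (le_of_eq ?_)
          rw [← mul_assoc, ← ENNReal.ofReal_mul (Real.rpow_nonneg hτ0.le _), Real.rpow_sub_one hτ0.ne',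
            div_eq_mul_inv]
      _ = (∫⁻ τ in Set.Ioi (1 : ℝ), ENNReal.ofReal (τ ^ (-α - 1))) * A := lintegral_mul_const' _ _ hA
      _ < ∞ := ENNReal.mul_lt_top h1.lintegral_lt_top hA.lt_top

theorem lintegral_fourierInv_schwartz_lt_top (g : 𝓢(V, ℂ)) :
    ∫⁻ x, ‖𝓕⁻ (g : V → ℂ) x‖ₑ < ∞ := by
  rw [← SchwartzMap.fourierInv_coe]
  exact (𝓕⁻ g).integrable.2

/-- The heat semigroup representation of a fractional power of the Laplacian gives an integrable
function. -/
theorem lintegral_fourierInv_lapSymbol_rpow_lt_top {α : ℝ} (hα : 0 < α) (hα1 : α < 1)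
    (ψ : 𝓢(V, ℂ)) :
    ∫⁻ x, ‖𝓕⁻ (fun ξ : V => ((lapSymbol ξ ^ α : ℝ) : ℂ) * ψ ξ) x‖ₑ < ∞ := by
  set Φ : V → ℝ → ℂ := fun x τ =>
    𝓕⁻ (fun ξ : V => ((lapSymbol ξ * Real.exp (-(lapSymbol ξ * τ)) : ℝ) : ℂ) * ψ ξ) x with hΦ
  have hΓ : 0 < Real.Gamma (1 - α) := Real.Gamma_pos_of_pos (by linarith)
  have hlm : Measurable (lapSymbol : V → ℝ) := continuous_lapSymbol.measurable
  have hψm : Measurable (ψ : V → ℂ) := ψ.continuous.measurable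
  -- the integrand of the double integral
  set F : V × ℝ → ℂ := fun p =>
    ((lapSymbol p.1 * Real.exp (-(lapSymbol p.1 * p.2)) * p.2 ^ (-α) : ℝ) : ℂ) * ψ p.1 with hF
  have hFm : Measurable F := by
    have h1 : Measurable fun p : V × ℝ => lapSymbol p.1 := hlm.comp measurable_fst
    have h2 : Measurable fun p : V × ℝ => ψ p.1 := hψm.comp measurable_fst
    exact (Complex.measurable_ofReal.comp ((h1.mul (h1.mul measurable_snd).neg.exp).mul
      (measurable_snd.pow_const _))).mul h2
  have hFnorm : ∀ ξ : V, ∫ τ in Set.Ioi 0, ‖F (ξ, τ)‖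
      = Real.Gamma (1 - α) * lapSymbol ξ ^ α * ‖ψ ξ‖ := by
    intro ξ
    rw [← integral_mul_exp_mul_rpow hα hα1 (lapSymbol_nonneg ξ), ← integral_mul_const]
    refine setIntegral_congr_fun measurableSet_Ioi fun τ hτ => ?_
    have hτ0 : (0 : ℝ) < τ := hτ
    have := lapSymbol_nonneg ξ
    simp only [hF]
    rw [norm_mul, Complex.norm_of_nonneg (by positivity)]
  have hrpow : ∀ ξ : V, lapSymbol ξ ^ α = (2 * Real.pi * ‖ξ‖) ^ (2 * α) := by
    intro ξ
    rw [lapSymbol, Real.rpow_mul (by positivity), Real.rpow_two]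
  have hint := integrable_rpow_mul_schwartz (V := V) (s := 2 * α) (by linarith) ψ
  -- Absolute integrability for Fubini: integrating in `τ` first returns `Γ(1 - α) λ^α ‖ψ‖` with `λ
  -- = lapSymbol ξ`, and the decay of `ψ` makes this integrable.
  have hFint : Integrable F (volume.prod (volume.restrict (Set.Ioi 0))) := by
    rw [integrable_prod_iff hFm.aestronglyMeasurable]
    refine ⟨Eventually.of_forall fun ξ => ?_, ?_⟩
    · exact Integrable.mul_const (Integrable.ofReal (𝕜 := ℂ)
        (integrableOn_mul_exp_mul_rpow hα1 (lapSymbol_nonneg ξ))) (ψ ξ)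
    · simp_rw [hFnorm]
      refine (hint.norm.const_mul (Real.Gamma (1 - α))).congr (Eventually.of_forall fun ξ => ?_)
      simp only
      rw [norm_mul, Complex.norm_of_nonneg (Real.rpow_nonneg (by positivity) _), hrpow]
      ring
  have hrep : ∀ x, (Real.Gamma (1 - α) : ℂ)
      * 𝓕⁻ (fun ξ : V => ((lapSymbol ξ ^ α : ℝ) : ℂ) * ψ ξ) x
      = ∫ τ in Set.Ioi 0, ((τ ^ (-α) : ℝ) : ℂ) * Φ x τ := by
    intro x
    have hint2 : Integrable (fun p : V × ℝ => ((Real.fourierChar ⟪p.1, x⟫ : Circle) : ℂ) * F p)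
        (volume.prod (volume.restrict (Set.Ioi 0))) := by
      refine hFint.bdd_mul (c := 1) ?_ (Eventually.of_forall fun p => (Circle.norm_coe _).le)
      have : Continuous fun p : V × ℝ => ((Real.fourierChar ⟪p.1, x⟫ : Circle) : ℂ) :=
        continuous_subtype_val.comp (Real.continuous_fourierChar.comp (by fun_prop))
      exact this.aestronglyMeasurable
    rw [← fourierInv_const_mul, Real.fourierInv_eq]
    calc _ = ∫ ξ, ∫ τ in Set.Ioi 0, ((Real.fourierChar ⟪ξ, x⟫ : Circle) : ℂ) * F (ξ, τ) := by
          refine integral_congr_ae (Eventually.of_forall fun ξ => ?_)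
          simp only [Circle.smul_def, smul_eq_mul, hF]
          rw [integral_const_mul, integral_mul_const, integral_complex_ofReal,
            integral_mul_exp_mul_rpow hα hα1 (lapSymbol_nonneg ξ)]
          push_cast
          ring
      _ = ∫ τ in Set.Ioi 0, ∫ ξ, ((Real.fourierChar ⟪ξ, x⟫ : Circle) : ℂ) * F (ξ, τ) :=
          integral_integral_swap hint2
      _ = _ := by
          refine integral_congr_ae (Eventually.of_forall fun τ => ?_)
          simp only [hΦ]
          rw [Real.fourierInv_eq, ← integral_const_mul]
          refine integral_congr_ae (Eventually.of_forall fun ξ => ?_)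
          simp only [Circle.smul_def, smul_eq_mul, hF]
          push_cast
          ring
  have hΦm : Measurable fun p : V × ℝ => Φ p.1 p.2 := by
    have : StronglyMeasurable fun q : (V × ℝ) × V =>
        ((Real.fourierChar ⟪q.2, q.1.1⟫ : Circle) : ℂ) *
          (((lapSymbol q.2 * Real.exp (-(lapSymbol q.2 * q.1.2)) : ℝ) : ℂ) * ψ q.2) := by
      have hl : Continuous fun q : (V × ℝ) × V => lapSymbol q.2 :=
        continuous_lapSymbol.comp continuous_snd
      have hψc : Continuous fun q : (V × ℝ) × V => ψ q.2 := ψ.continuous.comp continuous_snd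
      have h1 : Continuous fun q : (V × ℝ) × V => ((Real.fourierChar ⟪q.2, q.1.1⟫ : Circle) : ℂ) :=
        continuous_subtype_val.comp (Real.continuous_fourierChar.comp (by fun_prop))
      have hr : Continuous fun q : (V × ℝ) × V =>
          lapSymbol q.2 * Real.exp (-(lapSymbol q.2 * q.1.2)) := by fun_prop
      exact (h1.mul ((Complex.continuous_ofReal.comp hr).mul hψc)).stronglyMeasurable
    have h2 := this.integral_prod_right' (ν := (volume : Measure V))
    have e : (fun p : V × ℝ => Φ p.1 p.2) = fun p => ∫ ξ, ((Real.fourierChar ⟪ξ, p.1⟫ : Circle) : ℂ) *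
          (((lapSymbol ξ * Real.exp (-(lapSymbol ξ * p.2)) : ℝ) : ℂ) * ψ ξ) := by
      funext p
      simp only [hΦ]
      rw [Real.fourierInv_eq]
      rfl
    rw [e]
    exact h2.measurable
  have hsym : ∀ τ : ℝ, 0 < τ → ∀ ξ : V, lapSymbol (Real.sqrt τ • ξ) = lapSymbol ξ * τ := by
    intro τ hτ ξ
    rw [lapSymbol_smul, Real.sq_sqrt hτ.le, mul_comm]
  obtain ⟨g, hg⟩ := exists_schwartz_exp_neg_lapSymbol V
  -- For large `τ`: `λ e^{-λτ} = τ⁻¹ (λτ) e^{-λτ}`, and `(λτ) e^{-λτ}` is a dilate of a fixed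
  -- Schwartz function, so its kernel has constant `L¹` norm.
  have hb1 : ∀ τ : ℝ, 0 < τ → ∫⁻ x, ‖Φ x τ‖ₑ ≤ ENNReal.ofReal τ⁻¹ *
      ((∫⁻ x, ‖𝓕⁻ (lapSymbolMul g : V → ℂ) x‖ₑ) * ∫⁻ x, ‖(𝓕⁻ ψ) x‖ₑ) := by
    intro τ hτ
    have hsq := Real.sqrt_pos.2 hτ
    have e : ∀ x, Φ x τ = ((τ⁻¹ : ℝ) : ℂ) *
        𝓕⁻ (fun ξ => lapSymbolMul g (Real.sqrt τ • ξ) * ψ ξ) x := by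
      intro x
      rw [← fourierInv_const_mul]
      simp only [hΦ]
      refine congrArg (fun k : V → ℂ => (𝓕⁻ k : V → ℂ) x) (funext fun ξ => ?_)
      rw [lapSymbolMul_apply, hg, hsym τ hτ]
      have : (τ : ℂ) ≠ 0 := mod_cast hτ.ne'
      push_cast
      field_simp
    simp_rw [e, enorm_mul]
    rw [lintegral_const_mul' _ _ enorm_ne_top, ← ofReal_norm, Complex.norm_of_nonneg (by positivity)]
    gcongr
    refine (lintegral_enorm_fourierInv_mul_le
      ((lapSymbolMul g).integrable.comp_smul hsq.ne') ψ).trans (le_of_eq ?_)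
    rw [lintegral_enorm_fourierInv_comp_smul _ hsq]
  -- For small `τ`: the factor `λ` is moved onto `ψ`, leaving a dilate of the Gaussian.
  have hb2 : ∀ τ : ℝ, 0 < τ → ∫⁻ x, ‖Φ x τ‖ₑ ≤
      (∫⁻ x, ‖𝓕⁻ (g : V → ℂ) x‖ₑ) * ∫⁻ x, ‖(𝓕⁻ (lapSymbolMul ψ)) x‖ₑ := by
    intro τ hτ
    have hsq := Real.sqrt_pos.2 hτ
    have e : ∀ x, Φ x τ = 𝓕⁻ (fun ξ => g (Real.sqrt τ • ξ) * lapSymbolMul ψ ξ) x := by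
      intro x
      simp only [hΦ]
      refine congrArg (fun k : V → ℂ => (𝓕⁻ k : V → ℂ) x) (funext fun ξ => ?_)
      rw [lapSymbolMul_apply, hg, hsym τ hτ]
      push_cast
      ring
    simp_rw [e]
    refine (lintegral_enorm_fourierInv_mul_le
      (g.integrable.comp_smul hsq.ne') _).trans (le_of_eq ?_)
    rw [lintegral_enorm_fourierInv_comp_smul _ hsq]
  have hfin : ∫⁻ τ in Set.Ioi 0, ENNReal.ofReal (τ ^ (-α)) * ∫⁻ x, ‖Φ x τ‖ₑ < ∞ :=
    lintegral_rpow_mul_min_lt_top hα hα1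
      (ENNReal.mul_lt_top (lintegral_fourierInv_schwartz_lt_top _) (𝓕⁻ ψ).integrable.2).ne
      (ENNReal.mul_lt_top (lintegral_fourierInv_schwartz_lt_top _)
        (𝓕⁻ (lapSymbolMul ψ)).integrable.2).ne hb1 hb2
  have hmul : ENNReal.ofReal (Real.Gamma (1 - α)) *
      ∫⁻ x, ‖𝓕⁻ (fun ξ : V => ((lapSymbol ξ ^ α : ℝ) : ℂ) * ψ ξ) x‖ₑ < ∞ := by
    rw [← lintegral_const_mul' _ _ ENNReal.ofReal_ne_top]
    refine lt_of_le_of_lt ?_ hfin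
    calc _ ≤ ∫⁻ x, ∫⁻ τ in Set.Ioi 0, ENNReal.ofReal (τ ^ (-α)) * ‖Φ x τ‖ₑ := by
          refine lintegral_mono fun x => ?_
          have h1 : ENNReal.ofReal (Real.Gamma (1 - α)) *
              ‖𝓕⁻ (fun ξ : V => ((lapSymbol ξ ^ α : ℝ) : ℂ) * ψ ξ) x‖ₑ
              = ‖∫ τ in Set.Ioi 0, ((τ ^ (-α) : ℝ) : ℂ) * Φ x τ‖ₑ := by
            rw [← hrep, enorm_mul, ← ofReal_norm (Real.Gamma (1 - α) : ℂ),
              Complex.norm_of_nonneg hΓ.le]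
          simp only [h1]
          refine (enorm_integral_le_lintegral_enorm _).trans (le_of_eq ?_)
          refine setLIntegral_congr_fun measurableSet_Ioi fun τ hτ => ?_
          rw [enorm_mul, ← ofReal_norm ((τ ^ (-α) : ℝ) : ℂ),
            Complex.norm_of_nonneg (Real.rpow_nonneg (le_of_lt hτ) _)]
      _ = ∫⁻ τ in Set.Ioi 0, ∫⁻ x, ENNReal.ofReal (τ ^ (-α)) * ‖Φ x τ‖ₑ := by
          refine lintegral_lintegral_swap (Measurable.aemeasurable ?_)
          exact ((measurable_snd.pow_const _).ennreal_ofReal).mul hΦm.enorm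
      _ = _ := lintegral_congr fun τ => lintegral_const_mul' _ _ ENNReal.ofReal_ne_top
  exact ENNReal.lt_top_of_mul_ne_top_right hmul.ne (by simpa using hΓ)

/-- `|D|^s φ` is integrable for a Schwartz function `φ`. -/
theorem lintegral_fourierInv_rpow_lt_top {s : ℝ} (hs : 0 ≤ s) (ψ : 𝓢(V, ℂ)) :
    ∫⁻ x, ‖𝓕⁻ (fun ξ : V => (((2 * Real.pi * ‖ξ‖) ^ s : ℝ) : ℂ) * ψ ξ) x‖ₑ < ∞ := by
  -- Split `s / 2 = j + α` with `0 ≤ α < 1`. The integer power keeps `ψ` Schwartz, so only the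
  -- fractional power needs the heat representation.
  set j := ⌊s / 2⌋₊ with hj
  set α := s / 2 - j with hα
  have hα0 : 0 ≤ α := sub_nonneg.2 (Nat.floor_le (by positivity))
  have hα1 : α < 1 := by have := Nat.lt_floor_add_one (s / 2); linarith
  have e : (fun ξ : V => (((2 * Real.pi * ‖ξ‖) ^ s : ℝ) : ℂ) * ψ ξ)
      = fun ξ => ((lapSymbol ξ ^ α : ℝ) : ℂ) * (lapSymbolMul^[j] ψ) ξ := by
    ext ξ
    rw [lapSymbolMul_iterate_apply, ← mul_assoc, ← Complex.ofReal_mul, ← Real.rpow_natCast _ j,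
      ← Real.rpow_add_of_nonneg (lapSymbol_nonneg ξ) hα0 (Nat.cast_nonneg j), hα, sub_add_cancel,
      lapSymbol, ← Real.rpow_two, ← Real.rpow_mul (by positivity)]
    congr 4
    ring
  rw [e]
  rcases hα0.eq_or_lt with h | h
  · rw [← h]
    simp only [Real.rpow_zero, Complex.ofReal_one, one_mul]
    exact lintegral_fourierInv_schwartz_lt_top _
  · exact lintegral_fourierInv_lapSymbol_rpow_lt_top h hα1 _

end RieszSymbol

/-! ### Parabolic scaling of the symbol -/

section KernelSymbol

variable {V : Type*} [NormedAddCommGroup V]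

/-- The symbol `(2π|ξ|)^s e^{-ct|ξ|²}`. -/
def kernelSymbol (s : ℝ) (c : ℂ) (t : ℝ) (ξ : V) : ℂ :=
  (((2 * Real.pi * ‖ξ‖) ^ s : ℝ) : ℂ) * Complex.exp (-(c * t * ((‖ξ‖ ^ 2 : ℝ) : ℂ)))

theorem kernelSymbol_eq (s : ℝ) (c : ℂ) {t : ℝ} (ht : 0 < t) [NormedSpace ℝ V] (ξ : V) :
    kernelSymbol s c t ξ = ((t ^ (-(s / 2)) : ℝ) : ℂ) * kernelSymbol s c 1 (Real.sqrt t • ξ) := by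
  have h1 : (2 * Real.pi * ‖Real.sqrt t • ξ‖) ^ s = t ^ (s / 2) * (2 * Real.pi * ‖ξ‖) ^ s := by
    rw [norm_smul, Real.norm_of_nonneg (Real.sqrt_nonneg t),
      show 2 * Real.pi * (√t * ‖ξ‖) = √t * (2 * Real.pi * ‖ξ‖) by ring,
      Real.mul_rpow (Real.sqrt_nonneg t) (by positivity), Real.sqrt_eq_rpow,
      ← Real.rpow_mul ht.le]
    congr 2
    ring
  have h2 : ‖Real.sqrt t • ξ‖ ^ 2 = t * ‖ξ‖ ^ 2 := by
    rw [norm_smul, mul_pow, Real.norm_of_nonneg (Real.sqrt_nonneg t), Real.sq_sqrt ht.le]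
  rw [kernelSymbol, kernelSymbol, h1, h2, ← mul_assoc, ← Complex.ofReal_mul, ← mul_assoc,
    ← Real.rpow_add ht, neg_add_cancel, Real.rpow_zero, one_mul]
  congr 2
  push_cast
  ring

end KernelSymbol

/-! ### The kernel of `|D|^s` composed with a complex heat semigroup -/

section HeatKernel

variable {V : Type*} [NormedAddCommGroup V] [InnerProductSpace ℝ V] [FiniteDimensional ℝ V]
  [MeasurableSpace V] [BorelSpace V]

/-- The kernel of `|D|^s e^{(c/4π²)tΔ}`. -/
def kernel (s : ℝ) (c : ℂ) (t : ℝ) : V → ℂ := 𝓕⁻ (kernelSymbol s c t : V → ℂ)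

variable {s : ℝ} (hs : 0 ≤ s) {c : ℂ} (hc : 0 < c.re)
include hs hc

theorem integrable_kernelSymbol {t : ℝ} (ht : 0 < t) :
    Integrable (kernelSymbol s c t : V → ℂ) := by
  have h : 0 < (c * t).re := by rw [Complex.re_mul_ofReal]; positivity
  exact integrable_rpow_mul_schwartz hs (gaussian V (c * t) h)

theorem continuous_kernel {t : ℝ} (ht : 0 < t) : Continuous (kernel s c t : V → ℂ) :=
  continuous_fourierInv (integrable_kernelSymbol hs hc ht)

omit hs hc in
theorem kernel_neg (t : ℝ) (x : V) : kernel s c t (-x) = kernel s c t x :=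
  fourierInv_even (fun ξ => by simp only [kernelSymbol, norm_neg]) x

theorem lintegral_kernel_one_lt_top : ∫⁻ x : V, ‖kernel s c 1 x‖ₑ < ∞ := by
  have h : 0 < (c * (1 : ℝ)).re := by rw [Complex.re_mul_ofReal]; positivity
  exact lintegral_fourierInv_rpow_lt_top hs (gaussian V (c * (1 : ℝ)) h)

omit hs hc in
theorem lintegral_kernel {t : ℝ} (ht : 0 < t) :
    ∫⁻ x : V, ‖kernel s c t x‖ₑ
      = ENNReal.ofReal (t ^ (-(s / 2))) * ∫⁻ x : V, ‖kernel s c 1 x‖ₑ := by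
  have hsq := Real.sqrt_pos.2 ht
  have e : (kernelSymbol s c t : V → ℂ)
      = fun ξ => ((t ^ (-(s / 2)) : ℝ) : ℂ) * kernelSymbol s c 1 (Real.sqrt t • ξ) :=
    funext (kernelSymbol_eq s c ht)
  have e2 : ∀ x : V, ‖kernel s c t x‖ₑ = ENNReal.ofReal (t ^ (-(s / 2))) *
      ‖𝓕⁻ (fun ξ : V => kernelSymbol s c 1 (Real.sqrt t • ξ)) x‖ₑ := by
    intro x
    rw [kernel, e, fourierInv_const_mul, enorm_mul, ← ofReal_norm ((t ^ (-(s / 2)) : ℝ) : ℂ),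
      Complex.norm_of_nonneg (Real.rpow_nonneg ht.le _)]
  simp_rw [e2]
  rw [lintegral_const_mul' _ _ ENNReal.ofReal_ne_top, lintegral_enorm_fourierInv_comp_smul _ hsq]
  rfl

omit hs hc in
theorem norm_kernel_le {t : ℝ} (ht : 0 < t) (x : V) :
    ‖kernel s c t x‖ ≤ t ^ (-(s / 2) - (Module.finrank ℝ V : ℝ) / 2) *
      ∫ ξ : V, ‖kernelSymbol s c 1 ξ‖ := by
  have hsq := Real.sqrt_pos.2 ht
  have e : (kernelSymbol s c t : V → ℂ)
      = fun ξ => ((t ^ (-(s / 2)) : ℝ) : ℂ) * kernelSymbol s c 1 (Real.sqrt t • ξ) :=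
    funext (kernelSymbol_eq s c ht)
  have h3 : (√t ^ Module.finrank ℝ V)⁻¹ = t ^ (-((Module.finrank ℝ V : ℝ) / 2)) := by
    rw [Real.sqrt_eq_rpow, ← Real.rpow_natCast, ← Real.rpow_mul ht.le, ← Real.rpow_neg ht.le]
    congr 1
    ring
  rw [kernel, e, fourierInv_const_mul, fourierInv_comp_smul _ hsq, norm_mul, norm_mul,
    Complex.norm_of_nonneg (Real.rpow_nonneg ht.le _), Complex.norm_of_nonneg (by positivity),
    h3, sub_eq_add_neg, Real.rpow_add ht, mul_assoc]
  gcongr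
  exact norm_fourierInv_le _ _

end HeatKernel

/-! ### Young's inequality and symmetry of the pairing -/

section Convolution

variable {V : Type*} [NormedAddCommGroup V] [InnerProductSpace ℝ V] [FiniteDimensional ℝ V]
  [MeasurableSpace V] [BorelSpace V]

/-- The convolution `(H * f)(x) = ∫ H(x - y) f(y) dy`. -/
def conv (H f : V → ℂ) (x : V) : ℂ := ∫ y, H (x - y) * f y

theorem conv_comm (H f : V → ℂ) : conv H f = conv f H := by
  ext x
  rw [conv, conv, ← integral_sub_left_eq_self _ volume x]
  simp only [sub_sub_cancel]
  exact integral_congr_ae (Eventually.of_forall fun y => mul_comm _ _)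

theorem enorm_conv_le (H f : V → ℂ) (x : V) : ‖conv H f x‖ₑ ≤ ∫⁻ y, ‖H (x - y)‖ₑ * ‖f y‖ₑ := by
  refine (enorm_integral_le_lintegral_enorm _).trans (le_of_eq ?_)
  simp_rw [enorm_mul]

theorem rpow_mul_rpow_mul_ne_top {A M F p : ℝ≥0∞} (hA : A ≠ ∞) (hM : M ≠ ∞) (hp : 1 ≤ p)
    (hF : F ≠ ∞) : A ^ (1 - (p⁻¹).toReal) * M ^ (p⁻¹).toReal * F ≠ ∞ := by
  have h1 : (p⁻¹).toReal ≤ 1 := by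
    simpa using ENNReal.toReal_mono ENNReal.one_ne_top (ENNReal.inv_le_one.2 hp)
  exact ENNReal.mul_ne_top (ENNReal.mul_ne_top (ENNReal.rpow_ne_top_of_nonneg (by linarith) hA)
    (ENNReal.rpow_ne_top_of_nonneg ENNReal.toReal_nonneg hM)) hF

variable {H f : V → ℂ} (hH : Continuous H) (hf : AEStronglyMeasurable f volume)
include hH hf

/-- Hölder after splitting `‖H‖ = ‖H‖^{1 - 1/P} ‖H‖^{1/P}`, which leaves one full power of `‖H‖`
beside `‖f‖^P`, as Fubini requires. -/
theorem lintegral_conv_le_rpow {P : ℝ} (hP : 1 ≤ P) (x : V) :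
    ∫⁻ y, ‖H (x - y)‖ₑ * ‖f y‖ₑ
      ≤ (∫⁻ y, ‖H y‖ₑ) ^ (1 - P⁻¹) * (∫⁻ y, ‖H (x - y)‖ₑ * ‖f y‖ₑ ^ P) ^ P⁻¹ := by
  have hP0 : 0 < P := by linarith
  have hPi : P⁻¹ ≤ 1 := inv_le_one_of_one_le₀ hP
  have hHm : AEMeasurable fun y => ‖H (x - y)‖ₑ :=
    (hH.comp (continuous_const.sub continuous_id)).measurable.enorm.aemeasurable
  have h := ENNReal.lintegral_mul_norm_pow_le hHm (hHm.mul (hf.enorm.pow_const P))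
    (p := 1 - P⁻¹) (q := P⁻¹) (by linarith) (by positivity) (by ring)
  rw [lintegral_sub_left_eq_self (fun y => ‖H y‖ₑ) x] at h
  refine le_trans (le_of_eq (lintegral_congr fun y => ?_)) h
  simp only [Pi.mul_apply]
  rw [ENNReal.mul_rpow_of_nonneg _ _ (by positivity), ← ENNReal.rpow_mul, mul_inv_cancel₀ hP0.ne',
    ENNReal.rpow_one, ← mul_assoc, ← ENNReal.rpow_add_of_nonneg _ _ (by linarith) (by positivity),
    sub_add_cancel, ENNReal.rpow_one]

/-- Hölder's inequality in the form `‖H * f‖_∞ ≤ ‖H‖₁^{1-1/p} ‖H‖_∞^{1/p} ‖f‖_p`. -/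
theorem lintegral_conv_le {M : ℝ≥0∞} (hM : ∀ x, ‖H x‖ₑ ≤ M) {p : ℝ≥0∞} (hp : 1 ≤ p) (x : V) :
    ∫⁻ y, ‖H (x - y)‖ₑ * ‖f y‖ₑ
      ≤ (∫⁻ y, ‖H y‖ₑ) ^ (1 - (p⁻¹).toReal) * M ^ (p⁻¹).toReal * eLpNorm f p volume := by
  rcases eq_or_ne p ∞ with rfl | hp'
  · simp only [ENNReal.inv_top, ENNReal.toReal_zero, sub_zero, ENNReal.rpow_one,
      ENNReal.rpow_zero, mul_one, eLpNorm_exponent_top]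
    calc _ ≤ ∫⁻ y, ‖H (x - y)‖ₑ * eLpNormEssSup f volume := by
          refine lintegral_mono_ae ?_
          filter_upwards [enorm_ae_le_eLpNormEssSup f volume] with y hy
          gcongr
      _ = _ := by
        have hm : Measurable fun y => ‖H (x - y)‖ₑ :=
          (hH.comp (continuous_const.sub continuous_id)).measurable.enorm
        rw [lintegral_mul_const _ hm, lintegral_sub_left_eq_self (fun y => ‖H y‖ₑ) x]
  · have hp0 : p ≠ 0 := (zero_lt_one.trans_le hp).ne'
    have hP : 1 ≤ p.toReal := by simpa using ENNReal.toReal_mono hp' hp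
    have hP0 : 0 < p.toReal := by linarith
    rw [ENNReal.toReal_inv, eLpNorm_eq_lintegral_rpow_enorm_toReal hp0 hp', one_div]
    refine (lintegral_conv_le_rpow hH hf hP x).trans ?_
    rw [mul_assoc]
    gcongr
    rw [← ENNReal.mul_rpow_of_nonneg _ _ (by positivity)]
    gcongr
    rw [← lintegral_const_mul'' _ (hf.enorm.pow_const _)]
    gcongr
    exact hM _

theorem lintegral_lintegral_conv_rpow_le (hA : ∫⁻ y, ‖H y‖ₑ ≠ ∞) {P : ℝ} (hP : 1 ≤ P) :
    ∫⁻ x, (∫⁻ y, ‖H (x - y)‖ₑ * ‖f y‖ₑ) ^ P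
      ≤ (∫⁻ y, ‖H y‖ₑ) ^ P * ∫⁻ y, ‖f y‖ₑ ^ P := by
  have hP0 : 0 < P := by linarith
  set A := ∫⁻ y, ‖H y‖ₑ with hAdef
  calc _ ≤ ∫⁻ x, A ^ (P - 1) * ∫⁻ y, ‖H (x - y)‖ₑ * ‖f y‖ₑ ^ P := by
        refine lintegral_mono fun x => ?_
        refine (ENNReal.rpow_le_rpow (lintegral_conv_le_rpow hH hf hP x) hP0.le).trans
          (le_of_eq ?_)
        rw [ENNReal.mul_rpow_of_nonneg _ _ hP0.le, ← ENNReal.rpow_mul, ← ENNReal.rpow_mul,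
          inv_mul_cancel₀ hP0.ne', ENNReal.rpow_one, sub_mul, inv_mul_cancel₀ hP0.ne', one_mul]
    _ = A ^ (P - 1) * (A * ∫⁻ y, ‖f y‖ₑ ^ P) := by
        rw [lintegral_const_mul' _ _ (ENNReal.rpow_ne_top_of_nonneg (by linarith) hA),
          lintegral_lintegral_sub_mul hH.measurable.enorm.aemeasurable (hf.enorm.pow_const P)]
    _ = _ := by
        rw [← mul_assoc]
        congr 1
        nth_rewrite 2 [← ENNReal.rpow_one A]
        rw [← ENNReal.rpow_add_of_nonneg _ _ (by linarith) zero_le_one, sub_add_cancel]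

/-- Young's inequality for convolution with a bounded integrable kernel. -/
theorem eLpNorm_conv_le (hA : ∫⁻ y, ‖H y‖ₑ ≠ ∞) {M : ℝ≥0∞} (hM : ∀ x, ‖H x‖ₑ ≤ M)
    (hMtop : M ≠ ∞) {p q : ℝ≥0∞} (hp : 1 ≤ p) (hpq : p ≤ q) (hfp : eLpNorm f p volume ≠ ∞) :
    eLpNorm (conv H f) q volume
      ≤ (∫⁻ y, ‖H y‖ₑ) ^ (1 - ((p⁻¹).toReal - (q⁻¹).toReal))
        * M ^ ((p⁻¹).toReal - (q⁻¹).toReal) * eLpNorm f p volume := by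
  rcases eq_or_ne q ∞ with rfl | hq'
  · rw [eLpNorm_exponent_top]
    refine eLpNormEssSup_le_of_ae_enorm_bound (Eventually.of_forall fun x => ?_)
    simpa using (enorm_conv_le H f x).trans (lintegral_conv_le hH hf hM hp x)
  have hp' : p ≠ ∞ := fun h => hq' (top_le_iff.1 (h ▸ hpq))
  have hp0 : p ≠ 0 := (zero_lt_one.trans_le hp).ne'
  have hq0 : q ≠ 0 := (zero_lt_one.trans_le (hp.trans hpq)).ne'
  set P := p.toReal with hPdef
  set Q := q.toReal with hQdef
  have hP : 1 ≤ P := by simpa using ENNReal.toReal_mono hp' hp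
  have hPQ : P ≤ Q := ENNReal.toReal_mono hq' hpq
  have hP0 : 0 < P := by linarith
  have hQ0 : 0 < Q := by linarith
  set A := ∫⁻ y, ‖H y‖ₑ with hAdef
  set F := eLpNorm f p volume with hF
  have hFP : ∫⁻ y, ‖f y‖ₑ ^ P = F ^ P := by
    rw [hF, eLpNorm_eq_lintegral_rpow_enorm_toReal hp0 hp', ← ENNReal.rpow_mul, one_div,
      inv_mul_cancel₀ hP0.ne', ENNReal.rpow_one]
  have hinvP : (p⁻¹).toReal = P⁻¹ := ENNReal.toReal_inv p
  have hinvQ : (q⁻¹).toReal = Q⁻¹ := ENNReal.toReal_inv q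
  have hsup : ∀ x, ∫⁻ y, ‖H (x - y)‖ₑ * ‖f y‖ₑ ≤ A ^ (1 - P⁻¹) * M ^ P⁻¹ * F := fun x =>
    hinvP ▸ lintegral_conv_le hH hf hM hp x
  have hPi : P⁻¹ ≤ 1 := inv_le_one_of_one_le₀ hP
  have hQP : Q⁻¹ ≤ P⁻¹ := inv_anti₀ hP0 hPQ
  set S := A ^ (1 - P⁻¹) * M ^ P⁻¹ * F with hS
  have hStop : S ≠ ∞ := by
    rw [hS, ← hinvP]; exact rpow_mul_rpow_mul_ne_top hA hMtop hp hfp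
  rw [eLpNorm_eq_lintegral_rpow_enorm_toReal hq0 hq', hinvP, hinvQ, one_div]
  -- Interpolation between the `L^∞` and `L^P` bounds: `Q - P` powers of the convolution are
  -- estimated by its supremum bound `S`, and the remaining `P` powers by the case `q = p`.
  calc _ ≤ (∫⁻ x, S ^ (Q - P) * (∫⁻ y, ‖H (x - y)‖ₑ * ‖f y‖ₑ) ^ P) ^ Q⁻¹ := by
        refine ENNReal.rpow_le_rpow (lintegral_mono fun x => ?_) (by positivity)
        refine (ENNReal.rpow_le_rpow (enorm_conv_le H f x) hQ0.le).trans ?_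
        have e : ∀ z : ℝ≥0∞, z ^ Q = z ^ (Q - P) * z ^ P := fun z => by
          rw [← ENNReal.rpow_add_of_nonneg _ _ (sub_nonneg.2 hPQ) hP0.le, sub_add_cancel]
        rw [e]
        exact mul_le_mul' (ENNReal.rpow_le_rpow (hsup x) (sub_nonneg.2 hPQ)) le_rfl
    _ ≤ (S ^ (Q - P) * (A ^ P * F ^ P)) ^ Q⁻¹ := by
        refine ENNReal.rpow_le_rpow ?_ (by positivity)
        rw [lintegral_const_mul' _ _ (ENNReal.rpow_ne_top_of_nonneg (by linarith) hStop)]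
        gcongr
        exact (lintegral_lintegral_conv_rpow_le hH hf hA hP).trans_eq (by rw [hFP])
    _ = _ := by
        have h1 : (Q - P) * Q⁻¹ = 1 - P * Q⁻¹ := by field_simp
        have h2 : 0 ≤ 1 - P * Q⁻¹ := by
          rw [sub_nonneg, ← div_eq_mul_inv]; exact div_le_one_of_le₀ hPQ hQ0.le
        have h3 : 0 ≤ P * Q⁻¹ := by positivity
        have h4 : 0 ≤ P⁻¹ := by positivity
        have hE1 : (1 - P⁻¹) * (1 - P * Q⁻¹) + P * Q⁻¹ = 1 - (P⁻¹ - Q⁻¹) := by field_simp; ring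
        have hE2 : P⁻¹ * (1 - P * Q⁻¹) = P⁻¹ - Q⁻¹ := by field_simp
        rw [ENNReal.mul_rpow_of_nonneg _ _ (by positivity), ← ENNReal.rpow_mul, h1,
          ENNReal.mul_rpow_of_nonneg (A ^ P) _ (by positivity), ← ENNReal.rpow_mul, ← ENNReal.rpow_mul,
          hS, ENNReal.mul_rpow_of_nonneg _ _ h2, ENNReal.mul_rpow_of_nonneg _ _ h2,
          ← ENNReal.rpow_mul, ← ENNReal.rpow_mul, hE2, ← hE1,
          ENNReal.rpow_add_of_nonneg _ _ (mul_nonneg (by linarith) h2) h3]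
        have hFF : F ^ (1 - P * Q⁻¹) * F ^ (P * Q⁻¹) = F := by
          rw [← ENNReal.rpow_add_of_nonneg _ _ h2 h3, sub_add_cancel, ENNReal.rpow_one]
        nth_rewrite 3 [← hFF]
        ring

/-- Convolution with an even bounded integrable kernel is symmetric with respect to the
pairing. -/
theorem integrable_mul_conv_and_integral_eq (hA : ∫⁻ y, ‖H y‖ₑ ≠ ∞) {M : ℝ≥0∞} (hMtop : M ≠ ∞)
    (hM : ∀ x, ‖H x‖ₑ ≤ M) (hev : ∀ x, H (-x) = H x) {p : ℝ≥0∞} (hp : 1 ≤ p)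
    (hfp : eLpNorm f p volume ≠ ∞) {ψ : V → ℂ} (hψ : Integrable ψ) :
    Integrable (fun x => ψ x * conv H f x) ∧
      ∫ x, ψ x * conv H f x = ∫ y, conv H ψ y * f y := by
  have hS := rpow_mul_rpow_mul_ne_top hA hMtop hp hfp
  have hjoint : Integrable (fun z : V × V => ψ z.1 * (H (z.1 - z.2) * f z.2))
      (volume.prod volume) := by
    have hm : AEStronglyMeasurable (fun z : V × V => ψ z.1 * (H (z.1 - z.2) * f z.2))
        (volume.prod volume) :=
      (hψ.aestronglyMeasurable.comp_quasiMeasurePreserving Measure.quasiMeasurePreserving_fst).mul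
        ((hH.comp (continuous_fst.sub continuous_snd)).aestronglyMeasurable.mul
          (hf.comp_quasiMeasurePreserving Measure.quasiMeasurePreserving_snd))
    refine ⟨hm, ?_⟩
    rw [HasFiniteIntegral, lintegral_prod _ hm.enorm]
    calc _ = ∫⁻ x, ‖ψ x‖ₑ * ∫⁻ y, ‖H (x - y)‖ₑ * ‖f y‖ₑ := by
          refine lintegral_congr fun x => ?_
          simp_rw [enorm_mul]
          exact lintegral_const_mul' _ _ enorm_ne_top
      _ ≤ ∫⁻ x, ‖ψ x‖ₑ * ((∫⁻ y, ‖H y‖ₑ) ^ (1 - (p⁻¹).toReal) * M ^ (p⁻¹).toReal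
            * eLpNorm f p volume) := by
          gcongr with x
          exact lintegral_conv_le hH hf hM hp x
      _ = (∫⁻ x, ‖ψ x‖ₑ) * _ := lintegral_mul_const' _ _ hS
      _ < ∞ := ENNReal.mul_lt_top hψ.2 hS.lt_top
  refine ⟨?_, ?_⟩
  · refine hjoint.integral_prod_left.congr (Eventually.of_forall fun x => ?_)
    exact integral_const_mul (ψ x) fun y => H (x - y) * f y
  · calc _ = ∫ x, ∫ y, ψ x * (H (x - y) * f y) :=
          integral_congr_ae (Eventually.of_forall fun x => (integral_const_mul _ _).symm)
      _ = ∫ y, ∫ x, ψ x * (H (x - y) * f y) := integral_integral_swap hjoint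
      _ = _ := by
          refine integral_congr_ae (Eventually.of_forall fun y => ?_)
          simp only [conv]
          refine Eq.trans ?_ (integral_mul_const (f y) fun x => H (y - x) * ψ x)
          refine integral_congr_ae (Eventually.of_forall fun x => ?_)
          simp only
          rw [← hev (y - x), neg_sub]
          ring

end Convolution

/-! ### The characteristic polynomial of the system -/

section CharacteristicRoots

/-- This is the parabolicity of the system: each mode diffuses with a coefficient in the open right
half-plane. -/
theorem re_pos_of_cubic {z : ℂ} (hz : z ^ 3 - 2 * z ^ 2 + 3 * z - 1 = 0) : 0 < z.re := by
  by_contra! hx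
  have hre := congrArg Complex.re hz
  have him := congrArg Complex.im hz
  simp only [pow_succ, pow_zero, one_mul, Complex.sub_re, Complex.add_re, Complex.mul_re,
    Complex.sub_im, Complex.add_im, Complex.mul_im, Complex.re_ofNat, Complex.im_ofNat,
    Complex.one_re, Complex.one_im, Complex.zero_re, Complex.zero_im] at hre him
  set x := z.re
  set y := z.im
  have him' : y * (3 * x ^ 2 - y ^ 2 - 4 * x + 3) = 0 := by linear_combination him
  have h3 : x ^ 3 ≤ 0 := by nlinarith [mul_nonneg (neg_nonneg.2 hx) (sq_nonneg x)]
  rcases mul_eq_zero.1 him' with h | h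
  · rw [h] at hre
    nlinarith [sq_nonneg x]
  -- For a nonreal root the imaginary part determines `y²`. Inserting it in the real part leaves a
  -- cubic in `x` that is positive for `x ≤ 0`.
  · have hy : y ^ 2 = 3 * x ^ 2 - 4 * x + 3 := by linarith
    have : -8 * x ^ 3 + 16 * x ^ 2 - 14 * x + 5 = 0 := by
      linear_combination hre - (2 - 3 * x) * hy
    nlinarith [sq_nonneg x]

theorem injective_vecCons_three {α : Type*} {a b c : α} (hab : a ≠ b) (hac : a ≠ c)
    (hbc : b ≠ c) : Function.Injective ![a, b, c] := by
  intro i j hij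
  fin_cases i <;> fin_cases j
  exacts [rfl, absurd hij hab, absurd hij hac, absurd hij hab.symm, rfl, absurd hij hbc,
    absurd hij hac.symm, absurd hij hbc.symm, rfl]

theorem exists_characteristic_roots :
    ∃ l : Fin 3 → ℂ, Function.Injective l ∧
      ∀ j, l j ^ 3 - 2 * l j ^ 2 + 3 * l j - 1 = 0 := by
  open Polynomial in
  obtain ⟨a, ha⟩ : ∃ a : ℂ, a ^ 3 - 2 * a ^ 2 + 3 * a - 1 = 0 := by
    have hdeg : (X ^ 3 - C 2 * X ^ 2 + C 3 * X - C 1 : ℂ[X]).degree = 3 := by compute_degree!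
    obtain ⟨a, ha⟩ := IsAlgClosed.exists_root (X ^ 3 - C 2 * X ^ 2 + C 3 * X - C 1 : ℂ[X])
      (by rw [hdeg]; norm_num)
    exact ⟨a, by simpa using ha⟩
  -- `d` is a square root of the discriminant of the quadratic quotient of the cubic by `z - a`; the
  -- other two roots are `(2 - a ± d) / 2`.
  obtain ⟨d, hd⟩ := IsAlgClosed.exists_pow_nat_eq ((a - 2) ^ 2 - 4 * (a ^ 2 - 2 * a + 3))
    (n := 2) two_pos
  have hd0 : d ≠ 0 := by
    rintro rfl
    grind
  have hquad : ∀ b : ℂ, b ^ 2 + (a - 2) * b + (a ^ 2 - 2 * a + 3) = 0 →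
      b ^ 3 - 2 * b ^ 2 + 3 * b - 1 = 0 ∧ a ≠ b := by
    intro b hb
    refine ⟨by linear_combination (b - a) * hb + ha, ?_⟩
    rintro rfl
    grind
  obtain ⟨hb1, hb2⟩ := hquad ((2 - a + d) / 2) (by linear_combination hd / 4)
  obtain ⟨hc1, hc2⟩ := hquad ((2 - a - d) / 2) (by linear_combination hd / 4)
  have hbc : (2 - a + d) / 2 ≠ (2 - a - d) / 2 := by
    intro h
    exact hd0 (by linear_combination h)
  refine ⟨![a, (2 - a + d) / 2, (2 - a - d) / 2], injective_vecCons_three hb2 hc2 hbc,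
    fun j => ?_⟩
  fin_cases j
  exacts [ha, hb1, hc1]

theorem exists_combination {l : Fin 3 → ℂ} (hl : Function.Injective l) (w : Fin 3 → ℂ) :
    ∃ a : Fin 3 → ℂ, ∑ j, a j = w 0 ∧ ∑ j, a j * l j = w 1 ∧
      ∑ j, a j * (l j ^ 2 - l j + 1) = w 2 := by
  have hdet : IsUnit (Matrix.vandermonde l) := by
    rw [Matrix.isUnit_iff_isUnit_det, isUnit_iff_ne_zero]
    exact Matrix.det_vandermonde_ne_zero_iff.2 hl
  -- The third condition, rewritten with the first two, prescribes the second moment `∑ a j * l j ^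
  -- 2 = w 2 + w 1 - w 0`, which gives a pure Vandermonde system.
  obtain ⟨a, ha⟩ := Matrix.vecMul_surjective_iff_isUnit.2 hdet ![w 0, w 1, w 2 + w 1 - w 0]
  have h0 := congrFun ha 0
  have h1 := congrFun ha 1
  have h2 := congrFun ha 2
  simp [Matrix.vecMul, dotProduct, Matrix.vandermonde_apply, Fin.sum_univ_three] at h0 h1 h2
  refine ⟨a, ?_, ?_, ?_⟩ <;> rw [Fin.sum_univ_three]
  · exact h0
  · exact h1
  · linear_combination h2 - h1 + h0

end CharacteristicRoots

/-! ### `L^p`–`L^q` decay of the kernels -/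

section KernelEstimate

variable {V : Type*} [NormedAddCommGroup V] [InnerProductSpace ℝ V] [FiniteDimensional ℝ V]
  [MeasurableSpace V] [BorelSpace V]

theorem exists_enorm_kernel_le {s : ℝ} {c : ℂ} {t : ℝ} (ht : 0 < t) (x : V) :
    ‖kernel s c t x‖ₑ ≤ ENNReal.ofReal (t ^ (-(s / 2) - (Module.finrank ℝ V : ℝ) / 2)) *
      ENNReal.ofReal (∫ ξ : V, ‖kernelSymbol s c 1 ξ‖) := by
  rw [← ENNReal.ofReal_mul (Real.rpow_nonneg ht.le _), ← ofReal_norm]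
  exact ENNReal.ofReal_le_ofReal (norm_kernel_le ht x)

theorem lintegral_kernel_ne_top {s : ℝ} (hs : 0 ≤ s) {c : ℂ} (hc : 0 < c.re) {t : ℝ}
    (ht : 0 < t) : ∫⁻ x : V, ‖kernel s c t x‖ₑ ≠ ∞ := by
  rw [lintegral_kernel ht]
  exact ENNReal.mul_ne_top ENNReal.ofReal_ne_top (lintegral_kernel_one_lt_top hs hc).ne

variable (V) in
-- The mass of the kernel scales as `t^{-s/2}` and its supremum bound as `t^{-s/2 - n/2}`; Young's
-- inequality takes these with weights `1 - δ` and `δ = 1/p - 1/q`.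
theorem exists_eLpNorm_conv_kernel_le {s : ℝ} (hs : 0 ≤ s) {c : ℂ} (hc : 0 < c.re)
    {p q : ℝ≥0∞} (hp : 1 ≤ p) (hpq : p ≤ q) :
    ∃ K : ℝ≥0∞, K ≠ ∞ ∧ ∀ t : ℝ, 0 < t → ∀ f : V → ℂ, AEStronglyMeasurable f volume →
      eLpNorm f p volume ≠ ∞ →
      eLpNorm (conv (kernel s c t) f) q volume ≤
        K * ENNReal.ofReal (t ^ (-(s / 2 + (Module.finrank ℝ V : ℝ) / 2 *
          ((p⁻¹).toReal - (q⁻¹).toReal)))) * eLpNorm f p volume := by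
  set δ := (p⁻¹).toReal - (q⁻¹).toReal with hδ
  set n := Module.finrank ℝ V
  have hpi : p⁻¹ ≤ 1 := ENNReal.inv_le_one.2 hp
  have hδ0 : 0 ≤ δ := sub_nonneg.2 (ENNReal.toReal_mono (ne_top_of_le_ne_top ENNReal.one_ne_top hpi)
    (ENNReal.inv_le_inv.2 hpq))
  have hδ1 : 0 ≤ 1 - δ := by
    have h1 : (p⁻¹).toReal ≤ 1 := by simpa using ENNReal.toReal_mono ENNReal.one_ne_top hpi
    have h2 : 0 ≤ (q⁻¹).toReal := ENNReal.toReal_nonneg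
    linarith
  set A := ∫⁻ x : V, ‖kernel s c 1 x‖ₑ with hA
  set M := ENNReal.ofReal (∫ ξ : V, ‖kernelSymbol s c 1 ξ‖) with hM
  refine ⟨A ^ (1 - δ) * M ^ δ, ENNReal.mul_ne_top
    (ENNReal.rpow_ne_top_of_nonneg hδ1 (lintegral_kernel_one_lt_top hs hc).ne)
    (ENNReal.rpow_ne_top_of_nonneg hδ0 ENNReal.ofReal_ne_top), fun t ht f hf hfp => ?_⟩
  refine (eLpNorm_conv_le (continuous_kernel hs hc ht) hf (lintegral_kernel_ne_top hs hc ht)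
    (exists_enorm_kernel_le ht) (ENNReal.mul_ne_top ENNReal.ofReal_ne_top ENNReal.ofReal_ne_top)
    hp hpq hfp).trans (le_of_eq ?_)
  rw [lintegral_kernel ht, ENNReal.mul_rpow_of_nonneg _ _ hδ1, ENNReal.mul_rpow_of_nonneg _ _ hδ0,
    ENNReal.ofReal_rpow_of_pos (Real.rpow_pos_of_pos ht _),
    ENNReal.ofReal_rpow_of_pos (Real.rpow_pos_of_pos ht _), ← Real.rpow_mul ht.le,
    ← Real.rpow_mul ht.le]
  have e : -(s / 2 + (n : ℝ) / 2 * δ) = -(s / 2) * (1 - δ) + (-(s / 2) - (n : ℝ) / 2) * δ := by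
    ring
  rw [e, Real.rpow_add ht, ENNReal.ofReal_mul (Real.rpow_nonneg ht.le _)]
  ring

end KernelEstimate

/-! ### Kernels acting on Schwartz functions -/

section Conv

variable {V : Type*} [NormedAddCommGroup V] [InnerProductSpace ℝ V] [FiniteDimensional ℝ V]
  [MeasurableSpace V] [BorelSpace V]

theorem aestronglyMeasurable_conv {H f : V → ℂ} (hH : Continuous H)
    (hf : AEStronglyMeasurable f volume) : AEStronglyMeasurable (conv H f) volume :=
  AEStronglyMeasurable.integral_prod_right' (f := fun z : V × V => H (z.1 - z.2) * f z.2)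
    ((hH.comp (continuous_fst.sub continuous_snd)).aestronglyMeasurable.mul
      (hf.comp_quasiMeasurePreserving Measure.quasiMeasurePreserving_snd))

theorem kernelSymbol_zero {V : Type*} [NormedAddCommGroup V] (c : ℂ) (t : ℝ) (ξ : V) :
    kernelSymbol 0 c t ξ = Complex.exp (-(c * t * ((‖ξ‖ ^ 2 : ℝ) : ℂ))) := by
  rw [kernelSymbol, Real.rpow_zero, Complex.ofReal_one, one_mul]

theorem conv_kernel_apply {s : ℝ} (hs : 0 ≤ s) {c : ℂ} (hc : 0 < c.re) {t : ℝ} (ht : 0 < t)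
    (φ : 𝓢(V, ℂ)) (x : V) :
    conv (kernel s c t) φ x = 𝓕⁻ (fun ξ : V => kernelSymbol s c t ξ * (𝓕 φ) ξ) x := by
  rw [conv, kernel, integral_fourierInv_sub_mul (integrable_kernelSymbol hs hc ht) φ.integrable,
    SchwartzMap.fourier_coe]

theorem conv_kernel_zero_apply {c : ℂ} (hc : 0 < c.re) {t : ℝ} (ht : 0 < t)
    (φ : 𝓢(V, ℂ)) (x : V) :
    conv (kernel 0 c t) φ x = (𝓕⁻ (expMul c t (𝓕 φ))) x := by
  rw [conv_kernel_apply le_rfl hc ht, SchwartzMap.fourierInv_coe]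
  refine congrArg (fun k : V → ℂ => 𝓕⁻ k x) (funext fun ξ => ?_)
  rw [expMul_apply hc.le ht.le, kernelSymbol_zero]

theorem fourier_kernel_zero {c : ℂ} (hc : 0 < c.re) {t : ℝ} (ht : 0 < t) :
    Integrable (kernel 0 c t : V → ℂ) ∧
      𝓕 (kernel 0 c t : V → ℂ) = kernelSymbol 0 c t := by
  have h : 0 < (c * t).re := by rw [Complex.re_mul_ofReal]; positivity
  have e1 : (kernelSymbol 0 c t : V → ℂ) = gaussian V (c * t) h := by
    ext ξ
    rw [kernelSymbol_zero, gaussian_apply]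
  have e2 : (kernel 0 c t : V → ℂ) = 𝓕⁻ (gaussian V (c * t) h) := by
    rw [kernel, e1, SchwartzMap.fourierInv_coe]
  refine ⟨e2 ▸ SchwartzMap.integrable _, ?_⟩
  rw [e2, e1, ← SchwartzMap.fourier_coe, FourierTransform.fourier_fourierInv_eq]

/-- Transfers `|D|^s` from the test function to the kernel. The test function is then merely
integrable, so the convolution theorem is applied with the roles exchanged: the Gaussian kernel is
the factor that is Fourier transformed. -/
theorem conv_kernel_zero_fourierInv {s : ℝ} (hs : 0 ≤ s) {c : ℂ} (hc : 0 < c.re) {t : ℝ}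
    (ht : 0 < t) (φ : 𝓢(V, ℂ)) :
    conv (kernel 0 c t)
        (𝓕⁻ (fun ξ : V => (((2 * Real.pi * ‖ξ‖) ^ s : ℝ) : ℂ) * (𝓕 φ) ξ))
      = conv (kernel s c t) φ := by
  ext x
  obtain ⟨hK, hF⟩ := fourier_kernel_zero (V := V) hc ht
  rw [conv_comm, conv, integral_fourierInv_sub_mul (integrable_rpow_mul_schwartz hs (𝓕 φ)) hK, hF,
    conv_kernel_apply hs hc ht]
  refine congrArg (fun k : V → ℂ => 𝓕⁻ k x) (funext fun ξ => ?_)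
  rw [kernelSymbol_zero, kernelSymbol]
  ring

end Conv

/-! ### Riesz derivatives by duality -/

section RieszPair

variable {n : ℕ}

/-- `T` is given by `f` and `|D|^s f = g`. -/
def IsRieszPair (s : ℝ) (T : 𝓢'(EuclideanSpace ℝ (Fin n), ℂ))
    (f g : EuclideanSpace ℝ (Fin n) → ℂ) : Prop :=
  IsGivenBy T f ∧
    ∀ φ : 𝓢(EuclideanSpace ℝ (Fin n), ℂ),
      Integrable (fun x => rieszD s φ x * f x) volume ∧
      Integrable (fun x => φ x * g x) volume ∧
      ∫ x, rieszD s φ x * f x = ∫ x, φ x * g x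

theorem IsRieszPair.rieszNorm_le {s : ℝ} {T : 𝓢'(EuclideanSpace ℝ (Fin n), ℂ)}
    {f g : EuclideanSpace ℝ (Fin n) → ℂ} (h : IsRieszPair s T f g) (q : ℝ≥0∞) :
    rieszNorm s q T ≤ eLpNorm g q volume :=
  iInf₂_le g ⟨f, h⟩

theorem integrable_mul_sum_and_integral_eq {α ι : Type*} [MeasurableSpace α] {μ : Measure α}
    (S : Finset ι) (a : ι → ℂ) {ψ : α → ℂ} {f : ι → α → ℂ}
    (hf : ∀ j ∈ S, Integrable (fun x => ψ x * f j x) μ) :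
    Integrable (fun x => ψ x * ∑ j ∈ S, a j * f j x) μ ∧
      ∫ x, ψ x * ∑ j ∈ S, a j * f j x ∂μ = ∑ j ∈ S, a j * ∫ x, ψ x * f j x ∂μ := by
  have e : (fun x => ψ x * ∑ j ∈ S, a j * f j x) = fun x => ∑ j ∈ S, a j * (ψ x * f j x) := by
    ext x
    rw [Finset.mul_sum]
    exact Finset.sum_congr rfl fun j _ => mul_left_comm _ _ _
  rw [e]
  refine ⟨integrable_finsetSum S fun j hj => (hf j hj).const_mul (a j), ?_⟩
  rw [integral_finsetSum S fun j hj => (hf j hj).const_mul (a j)]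
  exact Finset.sum_congr rfl fun j _ => integral_const_mul _ _

/-- `rieszNorm` is an infimum, so linearity is handled on explicit representatives; the triangle
inequality is applied only afterwards, in `L^q`. -/
theorem IsRieszPair.sum {s : ℝ} {ι : Type*} (S : Finset ι) (a : ι → ℂ)
    {T : ι → 𝓢'(EuclideanSpace ℝ (Fin n), ℂ)} {f g : ι → EuclideanSpace ℝ (Fin n) → ℂ}
    (h : ∀ j ∈ S, IsRieszPair s (T j) (f j) (g j)) {T' : 𝓢'(EuclideanSpace ℝ (Fin n), ℂ)}
    (hT' : ∀ φ, T' φ = ∑ j ∈ S, a j * T j φ) :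
    IsRieszPair s T' (fun x => ∑ j ∈ S, a j * f j x) (fun x => ∑ j ∈ S, a j * g j x) := by
  refine ⟨fun φ => ?_, fun φ => ?_⟩
  · obtain ⟨h1, h2⟩ := integrable_mul_sum_and_integral_eq S a (fun j hj => ((h j hj).1 φ).1)
    refine ⟨h1, ?_⟩
    rw [h2, hT']
    exact Finset.sum_congr rfl fun j hj => by rw [((h j hj).1 φ).2]
  · obtain ⟨h1, h2⟩ := integrable_mul_sum_and_integral_eq S a (fun j hj => ((h j hj).2 φ).1)
    obtain ⟨h3, h4⟩ := integrable_mul_sum_and_integral_eq S a (fun j hj => ((h j hj).2 φ).2.1)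
    refine ⟨h1, h3, ?_⟩
    rw [h2, h4]
    exact Finset.sum_congr rfl fun j hj => by rw [((h j hj).2 φ).2.2]

theorem integrable_rieszD {s : ℝ} (hs : 0 ≤ s) (φ : 𝓢(EuclideanSpace ℝ (Fin n), ℂ)) :
    Integrable (rieszD s φ) :=
  ⟨(continuous_fourierInv (integrable_rpow_mul_schwartz hs (𝓕 φ))).aestronglyMeasurable,
    lintegral_fourierInv_rpow_lt_top hs (𝓕 φ)⟩

/-- The even kernel moves across the pairing onto the test function. This must work for every
integrable test function, since `|D|^s φ` need not be Schwartz. -/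
theorem isRieszPair_conv_kernel {s : ℝ} (hs : 0 ≤ s) {c : ℂ} (hc : 0 < c.re) {t : ℝ} (ht : 0 < t)
    {p : ℝ≥0∞} (hp : 1 ≤ p) {f : EuclideanSpace ℝ (Fin n) → ℂ}
    (hf : AEStronglyMeasurable f volume) (hfp : eLpNorm f p volume ≠ ∞)
    {T : 𝓢'(EuclideanSpace ℝ (Fin n), ℂ)}
    (hT : ∀ φ : 𝓢(EuclideanSpace ℝ (Fin n), ℂ), T φ = ∫ y, conv (kernel 0 c t) φ y * f y) :
    IsRieszPair s T (conv (kernel 0 c t) f) (conv (kernel s c t) f) := by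
  have key : ∀ {r : ℝ}, 0 ≤ r → ∀ {ψ : EuclideanSpace ℝ (Fin n) → ℂ}, Integrable ψ →
      Integrable (fun x => ψ x * conv (kernel r c t) f x) ∧
      ∫ x, ψ x * conv (kernel r c t) f x = ∫ y, conv (kernel r c t) ψ y * f y := fun hr ψ hψ =>
    integrable_mul_conv_and_integral_eq (continuous_kernel hr hc ht) hf
      (lintegral_kernel_ne_top hr hc ht)
      (ENNReal.mul_ne_top ENNReal.ofReal_ne_top ENNReal.ofReal_ne_top)
      (exists_enorm_kernel_le ht) (kernel_neg t) hp hfp hψ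
  refine ⟨fun φ => ?_, fun φ => ?_⟩
  · obtain ⟨h1, h2⟩ := key le_rfl φ.integrable
    exact ⟨h1, by rw [hT, h2]⟩
  · obtain ⟨h1, h2⟩ := key le_rfl (integrable_rieszD hs φ)
    obtain ⟨h3, h4⟩ := key hs φ.integrable
    refine ⟨h1, h3, ?_⟩
    rw [h2, h4, rieszD, conv_kernel_zero_fourierInv hs hc ht]

end RieszPair

/-! ### Diagonalizing the plate system -/

section Diagonalization

variable {V : Type*} [NormedAddCommGroup V] [InnerProductSpace ℝ V] [FiniteDimensional ℝ V]
  [MeasurableSpace V] [BorelSpace V]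

theorem laplacian_fourierInv (ψ : 𝓢(V, ℂ)) :
    Δ (𝓕⁻ ψ) = (-(4 * Real.pi ^ 2 : ℂ)) • 𝓕⁻ (normSqMul ψ) := by
  have h : SchwartzMap.fourierMultiplierCLM ℂ (fun ξ : V => ‖ξ‖ ^ 2) (𝓕⁻ ψ)
      = 𝓕⁻ (normSqMul ψ) := by
    rw [SchwartzMap.fourierMultiplierCLM_apply, FourierTransform.fourier_fourierInv_eq]
    congr 1
    ext ξ
    rw [normSqMul_apply, SchwartzMap.smulLeftCLM_apply_apply (by fun_prop), Complex.real_smul]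
  rw [SchwartzMap.laplacian_eq_fourierMultiplierCLM]
  change (-(2 * Real.pi) ^ 2) • SchwartzMap.fourierMultiplierCLM ℂ (fun ξ : V => ‖ξ‖ ^ 2) (𝓕⁻ ψ) = _
  rw [h]
  ext x
  simp only [smul_apply, Complex.real_smul, smul_eq_mul]
  push_cast
  ring

theorem neg_laplacian_apply {V : Type*} [NormedAddCommGroup V] [InnerProductSpace ℝ V]
    [FiniteDimensional ℝ V] (T : 𝓢'(V, ℂ)) (φ : 𝓢(V, ℂ)) : (-Δ T) φ = -(T (Δ φ)) := by
  rw [← TemperedDistribution.laplacian_apply_apply]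
  rfl

variable {n : ℕ} {u ut θ : ℝ → 𝓢'(EuclideanSpace ℝ (Fin n), ℂ)}
  {u₀ u₁ θ₀ : 𝓢'(EuclideanSpace ℝ (Fin n), ℂ)}

/-- The combination of `-Δu`, `u_t`, `θ` that solves a scalar heat equation when `l` is a root of
the characteristic polynomial of the plate system. -/
def mode (l : ℂ) (u ut θ : ℝ → 𝓢'(EuclideanSpace ℝ (Fin n), ℂ)) (t : ℝ) :
    𝓢'(EuclideanSpace ℝ (Fin n), ℂ) :=
  -Δ (u t) + l • ut t + (l ^ 2 - l + 1) • θ t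

theorem mode_apply (l : ℂ) (t : ℝ) (φ : 𝓢(EuclideanSpace ℝ (Fin n), ℂ)) :
    mode l u ut θ t φ = -(u t (Δ φ)) + l * ut t φ + (l ^ 2 - l + 1) * θ t φ := by
  rw [← neg_laplacian_apply]
  rfl

/-- The left eigenvector identity for `(1, l, l² - l + 1)`: the coefficients of `u` and `u_t` match
for any `l`, and the cubic is exactly what the `θ` coefficient requires. -/
theorem IsSolution.hasDerivAt_mode (h : IsSolution u ut θ u₀ u₁ θ₀) {l : ℂ}
    (hl : l ^ 3 - 2 * l ^ 2 + 3 * l - 1 = 0) (φ : 𝓢(EuclideanSpace ℝ (Fin n), ℂ)) {t : ℝ}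
    (ht : 0 < t) :
    HasDerivAt (fun τ => mode l u ut θ τ φ) (l * mode l u ut θ t (Δ φ)) t := by
  obtain ⟨utt, hutt, hplate⟩ := h.plate_eq φ t ht
  obtain ⟨θt, hθt, hheat⟩ := h.heat_eq φ t ht
  rw [neg_laplacian_apply] at hplate
  simp only [TemperedDistribution.laplacian_apply_apply] at hplate hheat
  simp only [mode_apply]
  refine ((((h.hasDerivAt_u (Δ φ) t ht).neg).add (hutt.const_mul l)).add
    (hθt.const_mul (l ^ 2 - l + 1))).congr_deriv ?_
  linear_combination l * hplate + (l ^ 2 - l + 1) * hheat - hl * θ t (Δ φ)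

theorem IsSolution.continuousOn_mode (h : IsSolution u ut θ u₀ u₁ θ₀) (l : ℂ)
    (φ : 𝓢(EuclideanSpace ℝ (Fin n), ℂ)) :
    ContinuousOn (fun τ => mode l u ut θ τ φ) (Set.Ici 0) := by
  simp only [mode_apply]
  exact ((h.continuousOn_u (Δ φ)).neg.add (continuousOn_const.mul (h.continuousOn_ut φ))).add
    (continuousOn_const.mul (h.continuousOn_θ φ))

/-- The Fourier transform of a tempered distribution as a continuous linear functional. -/
def fourierFunctional (T : 𝓢'(V, ℂ)) : 𝓢(V, ℂ) →L[ℂ] ℂ where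
  toFun ψ := T (𝓕⁻ ψ)
  map_add' ψ₁ ψ₂ := by rw [FourierTransform.fourierInv_add, map_add]
  map_smul' a ψ := by rw [FourierTransform.fourierInv_smul, map_smul]; rfl
  cont := T.cont.comp ContinuousFourierInv.continuous_fourierInv

/-- Uniqueness applied to the Fourier transform of the mode; the factor `4π²` comes from the
normalization of `𝓕`, under which `-Δ` has symbol `(2π‖ξ‖)²`. -/
theorem IsSolution.mode_eq (h : IsSolution u ut θ u₀ u₁ θ₀) {l : ℂ}
    (hl : l ^ 3 - 2 * l ^ 2 + 3 * l - 1 = 0) (φ : 𝓢(EuclideanSpace ℝ (Fin n), ℂ)) {t : ℝ}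
    (ht : 0 < t) :
    mode l u ut θ t φ
      = mode l u ut θ 0 (𝓕⁻ (expMul (((4 * Real.pi ^ 2 : ℝ) : ℂ) * l) t (𝓕 φ))) := by
  have hre : 0 ≤ (((4 * Real.pi ^ 2 : ℝ) : ℂ) * l).re := by
    rw [Complex.re_ofReal_mul]
    exact mul_nonneg (by positivity) (re_pos_of_cubic hl).le
  have := eq_expMul_of_hasDerivAt hre (fun τ => fourierFunctional (mode l u ut θ τ))
    (fun ψ => h.continuousOn_mode l (𝓕⁻ ψ))
    (fun ψ τ hτ => (h.hasDerivAt_mode hl (𝓕⁻ ψ) hτ).congr_deriv (by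
      rw [laplacian_fourierInv, map_smul, smul_eq_mul]
      change _ = -_ * mode l u ut θ τ (𝓕⁻ (normSqMul ψ))
      push_cast
      ring)) ht.le (𝓕 φ)
  change mode l u ut θ t (𝓕⁻ (𝓕 φ)) = _ at this
  rw [FourierTransform.fourierInv_fourier_eq] at this
  exact this

end Diagonalization

/-! ### Estimates for one mode and for combinations of modes -/

section Estimate

variable {n : ℕ}

theorem toTemperedDistribution_combination {p : ℝ≥0∞} [hp : Fact (1 ≤ p)] (a b : ℂ)
    (f₀ f₁ f₂ : Lp ℂ p (volume : Measure (EuclideanSpace ℝ (Fin n)))) :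
    Lp.toTemperedDistribution f₀ + a • Lp.toTemperedDistribution f₁
        + b • Lp.toTemperedDistribution f₂
      = Lp.toTemperedDistribution (f₀ + a • f₁ + b • f₂) := by
  simp only [← Lp.toTemperedDistributionCLM_apply, map_add, map_smul]

theorem eLpNorm_combination_le {p : ℝ≥0∞} [hp : Fact (1 ≤ p)] (a b : ℂ)
    (f₀ f₁ f₂ : Lp ℂ p (volume : Measure (EuclideanSpace ℝ (Fin n)))) :
    eLpNorm (f₀ + a • f₁ + b • f₂ : Lp ℂ p (volume : Measure (EuclideanSpace ℝ (Fin n)))) p volume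
      ≤ (1 + ‖a‖ₑ + ‖b‖ₑ) *
        (eLpNorm f₀ p volume + eLpNorm f₁ p volume + eLpNorm f₂ p volume) := by
  simp only [← Lp.enorm_def]
  calc ‖f₀ + a • f₁ + b • f₂‖ₑ ≤ ‖f₀‖ₑ + ‖a • f₁‖ₑ + ‖b • f₂‖ₑ :=
        (enorm_add_le _ _).trans (add_le_add_left (enorm_add_le _ _) _)
    _ = 1 * ‖f₀‖ₑ + ‖a‖ₑ * ‖f₁‖ₑ + ‖b‖ₑ * ‖f₂‖ₑ := by rw [enorm_smul, enorm_smul, one_mul]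
    _ ≤ (1 + ‖a‖ₑ + ‖b‖ₑ) * ‖f₀‖ₑ + (1 + ‖a‖ₑ + ‖b‖ₑ) * ‖f₁‖ₑ + (1 + ‖a‖ₑ + ‖b‖ₑ) * ‖f₂‖ₑ := by
        gcongr
        · rw [add_assoc]; exact le_self_add
        · exact le_add_self.trans le_self_add
        · exact le_add_self
    _ = _ := by ring

/-- A single mode is the convolution of a Gaussian kernel with its initial datum. -/
theorem exists_isRieszPair_mode {s : ℝ} (hs : 0 ≤ s) {p q : ℝ≥0∞} [hp : Fact (1 ≤ p)]
    (hpq : p ≤ q) {l : ℂ} (hl : l ^ 3 - 2 * l ^ 2 + 3 * l - 1 = 0) :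
    ∃ K : ℝ≥0∞, K ≠ ∞ ∧
      ∀ (u₀ u₁ θ₀ : 𝓢'(EuclideanSpace ℝ (Fin n), ℂ))
        (f₀ f₁ f₂ : Lp ℂ p (volume : Measure (EuclideanSpace ℝ (Fin n)))),
        -Δ u₀ = Lp.toTemperedDistribution f₀ →
        u₁ = Lp.toTemperedDistribution f₁ →
        θ₀ = Lp.toTemperedDistribution f₂ →
        ∀ u ut θ : ℝ → 𝓢'(EuclideanSpace ℝ (Fin n), ℂ),
          IsSolution u ut θ u₀ u₁ θ₀ → ∀ t : ℝ, 0 < t →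
            ∃ f g : EuclideanSpace ℝ (Fin n) → ℂ, IsRieszPair s (mode l u ut θ t) f g ∧
              AEStronglyMeasurable g volume ∧ eLpNorm g q volume ≤ K * ENNReal.ofReal
                (t ^ (-(s / 2 + (n : ℝ) / 2 * ((p⁻¹).toReal - (q⁻¹).toReal)))) *
                (eLpNorm f₀ p volume + eLpNorm f₁ p volume + eLpNorm f₂ p volume) := by
  set c : ℂ := ((4 * Real.pi ^ 2 : ℝ) : ℂ) * l with hc_def
  have hc : 0 < c.re := by
    rw [hc_def, Complex.re_ofReal_mul]
    exact mul_pos (by positivity) (re_pos_of_cubic hl)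
  obtain ⟨K, hK, hKle⟩ :=
    exists_eLpNorm_conv_kernel_le (EuclideanSpace ℝ (Fin n)) hs hc hp.out hpq
  rw [finrank_euclideanSpace_fin] at hKle
  refine ⟨K * (1 + ‖l‖ₑ + ‖l ^ 2 - l + 1‖ₑ), ENNReal.mul_ne_top hK (by finiteness), ?_⟩
  intro u₀ u₁ θ₀ f₀ f₁ f₂ h₀ h₁ h₂ u ut θ h t ht
  set F := f₀ + l • f₁ + (l ^ 2 - l + 1) • f₂ with hF
  have hF0 : mode l u ut θ 0 = Lp.toTemperedDistribution F := by
    rw [mode, h.initial_u, h.initial_ut, h.initial_θ, h₀, h₁, h₂,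
      toTemperedDistribution_combination]
  refine ⟨conv (kernel 0 c t) F, conv (kernel s c t) F,
    isRieszPair_conv_kernel hs hc ht hp.out (Lp.aestronglyMeasurable F) (Lp.eLpNorm_ne_top F)
      fun φ => ?_, ?_, ?_⟩
  · rw [h.mode_eq hl φ ht, hF0, Lp.toTemperedDistribution_apply]
    exact integral_congr_ae (Eventually.of_forall fun y =>
      congrArg (· * F y) (conv_kernel_zero_apply hc ht φ y).symm)
  · exact aestronglyMeasurable_conv (continuous_kernel hs hc ht) (Lp.aestronglyMeasurable F)
  · refine (hKle t ht F (Lp.aestronglyMeasurable F) (Lp.eLpNorm_ne_top F)).trans ?_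
    calc _ ≤ _ * ((1 + ‖l‖ₑ + ‖l ^ 2 - l + 1‖ₑ) * _) :=
          mul_le_mul_right (eLpNorm_combination_le l (l ^ 2 - l + 1) f₀ f₁ f₂) _
      _ = _ := by ring

/-- The weights `w` select a component of the solution. Expanding `w` in the three left eigenvectors
writes that component as a combination of modes, with coefficients independent of the data and of
time. -/
theorem exists_rieszNorm_combination_le (n : ℕ) {s : ℝ} (hs : 0 ≤ s) {p q : ℝ≥0∞}
    [hp : Fact (1 ≤ p)] (hpq : p ≤ q) (w : Fin 3 → ℂ) :
    ∃ K : ℝ≥0∞, K ≠ ∞ ∧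
      ∀ (u₀ u₁ θ₀ : 𝓢'(EuclideanSpace ℝ (Fin n), ℂ))
        (f₀ f₁ f₂ : Lp ℂ p (volume : Measure (EuclideanSpace ℝ (Fin n)))),
        -Δ u₀ = Lp.toTemperedDistribution f₀ →
        u₁ = Lp.toTemperedDistribution f₁ →
        θ₀ = Lp.toTemperedDistribution f₂ →
        ∀ u ut θ : ℝ → 𝓢'(EuclideanSpace ℝ (Fin n), ℂ),
          IsSolution u ut θ u₀ u₁ θ₀ → ∀ t : ℝ, 0 < t →
          ∀ T : 𝓢'(EuclideanSpace ℝ (Fin n), ℂ),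
            (∀ φ, T φ = w 0 * -(u t (Δ φ)) + w 1 * ut t φ + w 2 * θ t φ) →
            rieszNorm s q T ≤ K * ENNReal.ofReal
                (t ^ (-(s / 2 + (n : ℝ) / 2 * ((p⁻¹).toReal - (q⁻¹).toReal)))) *
                (eLpNorm f₀ p volume + eLpNorm f₁ p volume + eLpNorm f₂ p volume) := by
  obtain ⟨l, hinj, hl⟩ := exists_characteristic_roots
  obtain ⟨a, ha₀, ha₁, ha₂⟩ := exists_combination hinj w
  choose K hK hKle using fun j => exists_isRieszPair_mode (n := n) hs hpq (hl j)
  refine ⟨∑ j, ‖a j‖ₑ * K j,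
    ENNReal.sum_ne_top.2 fun j _ => ENNReal.mul_ne_top enorm_ne_top (hK j), ?_⟩
  intro u₀ u₁ θ₀ f₀ f₁ f₂ h₀ h₁ h₂ u ut θ h t ht T hT
  choose f g hpair hg hgle using fun j => hKle j u₀ u₁ θ₀ f₀ f₁ f₂ h₀ h₁ h₂ u ut θ h t ht
  have hsum : IsRieszPair s T (fun x => ∑ j, a j * f j x) (fun x => ∑ j, a j * g j x) := by
    refine IsRieszPair.sum Finset.univ a (fun j _ => hpair j) fun φ => ?_
    rw [hT, ← ha₀, ← ha₁, ← ha₂]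
    simp only [mode_apply, Finset.sum_mul, ← Finset.sum_add_distrib]
    exact Finset.sum_congr rfl fun j _ => by ring
  refine (hsum.rieszNorm_le q).trans ?_
  have e : (fun x => ∑ j, a j * g j x) = ∑ j, a j • g j := by
    ext x
    simp only [Finset.sum_apply, Pi.smul_apply, smul_eq_mul]
  rw [e]
  refine (eLpNorm_sum_le (fun j _ => (hg j).const_smul (a j)) (hp.out.trans hpq)).trans ?_
  rw [Finset.sum_mul, Finset.sum_mul]
  refine Finset.sum_le_sum fun j _ => ?_
  rw [eLpNorm_const_smul, mul_assoc, mul_assoc, ← mul_assoc (K j)]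
  exact mul_le_mul_right (hgle j) _

end Estimate

end ThermoPlate

end

/-! ### The theorem: the three components together -/

theorem mainTheorem9 (n : ℕ) (hn : 1 ≤ n) (s : ℝ) (hs : 0 ≤ s) (p q : ℝ≥0∞)
    [hp : Fact (1 ≤ p)] (hpq : p ≤ q) :
    ∃ C : ℝ, 0 < C ∧
      ∀ (u₀ u₁ θ₀ : 𝓢'(EuclideanSpace ℝ (Fin n), ℂ))
        (f₀ f₁ f₂ : Lp ℂ p (volume : Measure (EuclideanSpace ℝ (Fin n)))),
        -Δ u₀ = Lp.toTemperedDistribution f₀ →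
        u₁ = Lp.toTemperedDistribution f₁ →
        θ₀ = Lp.toTemperedDistribution f₂ →
        ∀ u ut θ : ℝ → 𝓢'(EuclideanSpace ℝ (Fin n), ℂ),
          ThermoPlate.IsSolution u ut θ u₀ u₁ θ₀ →
          ∀ t : ℝ, 0 < t →
            ThermoPlate.rieszNorm s q (-Δ (u t)) + ThermoPlate.rieszNorm s q (ut t)
                + ThermoPlate.rieszNorm s q (θ t)
              ≤ ENNReal.ofReal
                  (C * t ^ (-(s / 2 + (n : ℝ) / 2 * ((p⁻¹).toReal - (q⁻¹).toReal))))
                * (eLpNorm f₀ p volume + eLpNorm f₁ p volume + eLpNorm f₂ p volume) := by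
  obtain ⟨K₀, hK₀, h₀⟩ := ThermoPlate.exists_rieszNorm_combination_le n hs hpq ![1, 0, 0]
  obtain ⟨K₁, hK₁, h₁⟩ := ThermoPlate.exists_rieszNorm_combination_le n hs hpq ![0, 1, 0]
  obtain ⟨K₂, hK₂, h₂⟩ := ThermoPlate.exists_rieszNorm_combination_le n hs hpq ![0, 0, 1]
  have hK : K₀ + K₁ + K₂ ≠ ∞ := by finiteness
  -- Adding `1` makes the constant strictly positive even if all `K` vanish.
  refine ⟨(K₀ + K₁ + K₂).toReal + 1, by positivity, ?_⟩
  intro u₀ u₁ θ₀ f₀ f₁ f₂ hu₀ hu₁ hθ₀ u ut θ h t ht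
  have e₀ := h₀ u₀ u₁ θ₀ f₀ f₁ f₂ hu₀ hu₁ hθ₀ u ut θ h t ht (-Δ (u t)) fun φ => by
    simp
  have e₁ := h₁ u₀ u₁ θ₀ f₀ f₁ f₂ hu₀ hu₁ hθ₀ u ut θ h t ht (ut t) fun φ => by
    simp
  have e₂ := h₂ u₀ u₁ θ₀ f₀ f₁ f₂ hu₀ hu₁ hθ₀ u ut θ h t ht (θ t) fun φ => by
    simp
  refine (add_le_add (add_le_add e₀ e₁) e₂).trans ?_
  rw [← add_mul, ← add_mul, ← add_mul, ← add_mul, ENNReal.ofReal_mul (by positivity)]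
  gcongr
  rw [ENNReal.ofReal_add ENNReal.toReal_nonneg zero_le_one, ENNReal.ofReal_toReal hK]
  exact le_self_add
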